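/- Let $D\subset\mathbb R^d$ ($d\ge 1$) be a bounded domain with smooth boundary, let $k>0$, $\gamma,\delta,\eta\ge 0$, $p,q,n>1$, $m\ge 0$ with $m+n\ge q\ge p$, and let $f:D\to[0,\infty)$ be bounded, of class $C^2$ and not identically zero. Let $\frac12<H<1$ and let $B^H$ be a standard one-dimensional fractional Brownian motion with Hurst parameter $H$ (a centered Gaussian process with $E[B^H(t)B^H(s)]=\frac12(s^{2H}+t^{2H}-|t-s|^{2H})$ and a.s. continuous paths), adapted to the filtration of a filtered probability space $(\Omega,\mathcal F,(\mathcal F_t)_{t\ge0},\mathbb P)$. Let $\tau$ be a stopping time with values in $[0,\infty]$. Consider the stochastic equation $$du=\Big[(\Delta+\gamma)u+\int_D u^q(t,y)\,dy-ku^p+\delta u^m\int_D u^n(t,y)\,dy\Big]dt+\eta u\,dB^H(t)\qquad(1)$$ and the random partial differential equation $$\frac{\partial v}{\partial t}=(\Delta+\gamma)v+e^{(q-1)\eta B^H(t)}\int_D v^q(t,y)\,dy-ke^{(p-1)\eta B^H(t)}v^p+\delta e^{(m+n-1)\eta B^H(t)}v^m\int_D v^n(t,y)\,dy,\qquad(2)$$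 both on $D$ with zero boundary values on $\partial D$ for $t>0$ and initial value $f$ at $t=0$. Write $w(t,\varphi)=\int_D w(t,x)\varphi(x)\,dx$ and $w^r(t,\varphi)=\int_D w(t,x)^r\varphi(x)\,dx$. An admissible field is an adapted real random field $w=\{w(t,x):t\ge0,\ x\in D\}$ such that almost surely: $w$ is continuous and non-negative on $[0,\tau)\times D$; $w(0,x)=f(x)$ for $x\in D$; $w(t,y)\to0$ as $y\to x$, $y\in D$, for every $t\in(0,\tau)$ and $x\in\partial D$; and $w^q$ and $w^n$ are integrable on $(0,t)\times D$ for every $0\le t<\tau$. An admissible field $u$ is a weak solution of (1) on $(0,\tau)$ if for every $\varphi\in C_0^\infty(D)$, almost surely, for all $0\le t<\tau$ the integral $\int_0^t u(s,\varphi)\,dB^H(s)$ exists as a pathwise Riemann–Stieltjes integral (limit of the sums over tagged partitions with arbitrary tags as the mesh tends to $0$) and $$u(t,\varphi)=u(0,\varphi)+\int_0^t u(s,(\Delta+\gamma)\varphi)\,ds+\int_0^t\!\int_D u^q(s,y)\,dy\int_D\varphi(z)\,dz\,ds-k\int_0^t u^p(s,\varphi)\,ds+\delta\int_0^t u^m(s,\varphi)\int_D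 u^n(s,y)\,dy\,ds+\eta\int_0^t u(s,\varphi)\,dB^H(s).$$ An admissible field $v$ is a weak solution of (2) on $(0,\tau)$ if for every $\varphi\in C_0^\infty(D)$, almost surely, for all $0\le t<\tau$, $$v(t,\varphi)=v(0,\varphi)+\int_0^t v(s,(\Delta+\gamma)\varphi)\,ds+\int_0^t e^{(q-1)\eta B^H(s)}\int_D v^q(s,y)\,dy\int_D\varphi(z)\,dz\,ds-k\int_0^t e^{(p-1)\eta B^H(s)}v^p(s,\varphi)\,ds+\delta\int_0^t e^{(m+n-1)\eta B^H(s)}v^m(s,\varphi)\int_D v^n(s,y)\,dy\,ds.$$ Then, for every real random field $u=\{u(t,x):t\ge0,\ x\in D\}$, $u$ is a weak solution of (1) on $(0,\tau)$ if and only if the field $v(t,x)=e^{-\eta B^H(t)}u(t,x)$ is a weak solution of (2) on $(0,\tau)$. -/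

import Mathlib

open MeasureTheory ProbabilityTheory Set Filter Topology
open scoped NNReal

namespace NonlocalSPDE

/-- The Euclidean space `ℝ^d`. -/
abbrev Space (d : ℕ) := EuclideanSpace ℝ (Fin d)

/-- The boundary of `D` is smooth: near each of its points, `D` is the side `ρ < 0` of a level set of
a smooth function `ρ` without critical points. -/
def HasSmoothBoundary {d : ℕ} (D : Set (Space d)) : Prop :=
  ∀ x ∈ frontier D, ∃ (U : Set (Space d)) (ρ : Space d → ℝ),
    IsOpen U ∧ x ∈ U ∧ ContDiffOn ℝ (⊤ : ℕ∞) ρ U ∧ (∀ y ∈ U, fderiv ℝ ρ y ≠ 0) ∧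
      D ∩ U = {y ∈ U | ρ y < 0}

/-- `B` is a standard one-dimensional fractional Brownian motion of Hurst parameter `H` on the
probability space `(Ω, P)`: a centered Gaussian process with the covariance
`(s ^ 2H + t ^ 2H - |t - s| ^ 2H) / 2` and with almost surely continuous paths. -/
structure IsFractionalBrownianMotion {Ω : Type*} [MeasurableSpace Ω] (P : Measure Ω)
    (H : ℝ) (B : ℝ≥0 → Ω → ℝ) : Prop where
  gaussian : IsGaussianProcess B P
  centered : ∀ t, ∫ ω, B t ω ∂P = 0
  covariance : ∀ s t : ℝ≥0, ∫ ω, B t ω * B s ω ∂P =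
    (1 / 2) * ((s : ℝ) ^ (2 * H) + (t : ℝ) ^ (2 * H) - |(t : ℝ) - s| ^ (2 * H))
  continuous_paths : ∀ᵐ ω ∂P, Continuous fun t => B t ω

/-- `I` is the Riemann-Stieltjes integral `∫_0^t X dg`: the Riemann-Stieltjes sums over the tagged
partitions `0 = π 0 ≤ … ≤ π N = t` with tags `ξ i ∈ [π i, π (i + 1)]` converge to `I` as the mesh
tends to `0`. -/
def HasRSIntegral (X g : ℝ≥0 → ℝ) (t : ℝ≥0) (I : ℝ) : Prop :=
  ∀ ε : ℝ, 0 < ε → ∃ δ : ℝ, 0 < δ ∧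
    ∀ (N : ℕ) (π ξ : ℕ → ℝ≥0), Monotone π → π 0 = 0 → π N = t →
      (∀ i < N, ξ i ∈ Icc (π i) (π (i + 1))) →
      (∀ i < N, (π (i + 1) : ℝ) - π i < δ) →
        |(∑ i ∈ Finset.range N, X (ξ i) * (g (π (i + 1)) - g (π i))) - I| < ε

/-- The Lebesgue integral `∫_0^t F(s) ds` of a function on `[0, ∞)`. -/
noncomputable def timeIntegral (F : ℝ≥0 → ℝ) (t : ℝ≥0) : ℝ :=
  ∫ s in (0 : ℝ)..t, F s.toNNReal

/-- `φ ∈ C_0^∞(D)`: a smooth function with compact support contained in `D`. -/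
structure IsTestFunction {d : ℕ} (D : Set (Space d)) (φ : Space d → ℝ) : Prop where
  smooth : ContDiff ℝ (⊤ : ℕ∞) φ
  compact : HasCompactSupport φ
  support : tsupport φ ⊆ D

/-- The requirements, common to both equations, on a random field `u(t, x)` (written `u t x ω`)
that is to be a weak solution up to the random time `τ` with exponents `q` and `n` in the non-local
terms: it is adapted; almost surely it is continuous and non-negative on `[0, τ) × D`, starts
from `f`, tends to `0` at `∂D` at each time in `(0, τ)`, and its powers `u ^ q` and `u ^ n`, which
occur in the non-local terms, are integrable on `(0, t) × D` for each `t < τ`. -/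
structure IsSolutionField {Ω : Type*} [MeasurableSpace Ω] (P : Measure Ω)
    (𝓕 : Filtration ℝ≥0 ‹MeasurableSpace Ω›) (τ : Ω → WithTop ℝ≥0)
    {d : ℕ} (D : Set (Space d)) (f : Space d → ℝ) (q n : ℝ)
    (u : ℝ≥0 → Space d → Ω → ℝ) : Prop where
  adapted : ∀ x ∈ D, StronglyAdapted 𝓕 fun t => u t x
  continuous : ∀ᵐ ω ∂P,
    ContinuousOn (fun z : ℝ≥0 × Space d => u z.1 z.2 ω) ({t : ℝ≥0 | (t : WithTop ℝ≥0) < τ ω} ×ˢ D)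
  nonneg : ∀ᵐ ω ∂P, ∀ t : ℝ≥0, (t : WithTop ℝ≥0) < τ ω → ∀ x ∈ D, 0 ≤ u t x ω
  initial : ∀ᵐ ω ∂P, ∀ x ∈ D, u 0 x ω = f x
  boundary : ∀ᵐ ω ∂P, ∀ t : ℝ≥0, 0 < t → (t : WithTop ℝ≥0) < τ ω →
    ∀ x ∈ frontier D, Tendsto (fun y => u t y ω) (𝓝[D] x) (𝓝 0)
  integrable_q : ∀ᵐ ω ∂P, ∀ t : ℝ≥0, (t : WithTop ℝ≥0) < τ ω →
    IntegrableOn (fun z : ℝ × Space d => u z.1.toNNReal z.2 ω ^ q) (Ioc (0 : ℝ) t ×ˢ D)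
  integrable_n : ∀ᵐ ω ∂P, ∀ t : ℝ≥0, (t : WithTop ℝ≥0) < τ ω →
    IntegrableOn (fun z : ℝ × Space d => u z.1.toNNReal z.2 ω ^ n) (Ioc (0 : ℝ) t ×ˢ D)

/-- `u` is a weak solution on `(0, τ)` of
`du = [(Δ + γ) u + ∫_D u^q dy - k u^p + δ u^m ∫_D u^n dy] dt + η u dB`,
`u = 0` on `∂D`, `u(0, ·) = f`. The stochastic integral `∫_0^t u(s, φ) dB(s)`, where
`u(s, φ) = ∫_D u(s, x) φ(x) dx`, is the pathwise one, and its existence is part of the definition. -/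
structure IsWeakSolutionSPDE {Ω : Type*} [MeasurableSpace Ω] (P : Measure Ω)
    (𝓕 : Filtration ℝ≥0 ‹MeasurableSpace Ω›) (B : ℝ≥0 → Ω → ℝ) (τ : Ω → WithTop ℝ≥0)
    {d : ℕ} (D : Set (Space d)) (f : Space d → ℝ) (k γ δ η p q m n : ℝ)
    (u : ℝ≥0 → Space d → Ω → ℝ) : Prop where
  field : IsSolutionField P 𝓕 τ D f q n u
  equation : ∀ φ : Space d → ℝ, IsTestFunction D φ →
    ∀ᵐ ω ∂P, ∀ t : ℝ≥0, (t : WithTop ℝ≥0) < τ ω →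
      ∃ I : ℝ,
        HasRSIntegral (fun s => ∫ x in D, u s x ω * φ x) (fun s => B s ω) t I ∧
        ∫ x in D, u t x ω * φ x =
          (∫ x in D, u 0 x ω * φ x)
          + timeIntegral (fun s => ∫ x in D, u s x ω * (Laplacian.laplacian φ x + γ * φ x)) t
          + timeIntegral (fun s => (∫ y in D, u s y ω ^ q) * ∫ z in D, φ z) t
          - k * timeIntegral (fun s => ∫ x in D, u s x ω ^ p * φ x) t
          + δ * timeIntegral
              (fun s => (∫ x in D, u s x ω ^ m * φ x) * ∫ y in D, u s y ω ^ n) t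
          + η * I

/-- `v` is a weak solution on `(0, τ)` of the random partial differential equation
`∂v/∂t = (Δ + γ) v + e^{(q-1)ηB} ∫_D v^q dy - k e^{(p-1)ηB} v^p + δ e^{(m+n-1)ηB} v^m ∫_D v^n dy`,
`v = 0` on `∂D`, `v(0, ·) = f`. -/
structure IsWeakSolutionRandomPDE {Ω : Type*} [MeasurableSpace Ω] (P : Measure Ω)
    (𝓕 : Filtration ℝ≥0 ‹MeasurableSpace Ω›) (B : ℝ≥0 → Ω → ℝ) (τ : Ω → WithTop ℝ≥0)
    {d : ℕ} (D : Set (Space d)) (f : Space d → ℝ) (k γ δ η p q m n : ℝ)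
    (v : ℝ≥0 → Space d → Ω → ℝ) : Prop where
  field : IsSolutionField P 𝓕 τ D f q n v
  equation : ∀ φ : Space d → ℝ, IsTestFunction D φ →
    ∀ᵐ ω ∂P, ∀ t : ℝ≥0, (t : WithTop ℝ≥0) < τ ω →
      ∫ x in D, v t x ω * φ x =
        (∫ x in D, v 0 x ω * φ x)
        + timeIntegral (fun s => ∫ x in D, v s x ω * (Laplacian.laplacian φ x + γ * φ x)) t
        + timeIntegral (fun s => Real.exp ((q - 1) * η * B s ω) *
            ((∫ y in D, v s y ω ^ q) * ∫ z in D, φ z)) t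
        - k * timeIntegral (fun s => Real.exp ((p - 1) * η * B s ω) *
            ∫ x in D, v s x ω ^ p * φ x) t
        + δ * timeIntegral (fun s => Real.exp ((m + n - 1) * η * B s ω) *
            ((∫ x in D, v s x ω ^ m * φ x) * ∫ y in D, v s y ω ^ n)) t

end NonlocalSPDE

namespace NonlocalSPDE

/-! The equivalence is proved path by path. Tested with `φ`, equation (1) becomes a scalar equation
`X(t) = X(0) + ∫ a ds + η ∫ X dg`, with `X(t) = u(t, φ)` and `g` a path of `B`. The claim is that it
amounts to `e^{-ηg(t)} X(t) = e^{-ηg(0)} X(0) + ∫ e^{-ηg} a ds`, which is (2) tested with `φ` once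
the powers of `e^{-ηg}` are collected. This scalar statement is `linear_noise_iff`.

No Itô correction appears because `H > 1/2`: on bounded time intervals `(g(s) - g(r))^2` is
uniformly `o(s - r)`, by moment bounds on dyadic increments and chaining
(`ae_hasSmallSquaredIncrements`). Second-order Taylor remainders therefore vanish when summed over a
partition.

From (2) to (1), `Y = e^{-ηg} X` is an integral function. Writing `X = e^{ηg} Y` and `P = e^{ηg} /
η`, the Riemann-Stieltjes sums of `X dg` are compared with the telescoping increments of `P Y`; this
gives both the existence and the value of the integral (`hasRSIntegral_of_quadraticExpansion`).

From (1) to (2), `X` is only known to be continuous with an existing integral, and no Hölder bound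
on `X` is at hand. Henstock's lemma (`HasRSIntegral.sum_abs_le`) replaces one: the errors `I(s) -
I(r) - X(s)(g(s) - g(r))` have a small sum of absolute values, so they stay small after
multiplication by the bounded weights `e^{-ηg}` (`product_eq_integral_of_linear_noise`). -/

/-- On `[0, T]`, the increments of `g` are of smaller order than the square root of the length of
the time interval, uniformly. -/
def HasSmallSquaredIncrements (g : ℝ≥0 → ℝ) (T : ℝ≥0) : Prop :=
  ∀ ε : ℝ, 0 < ε → ∃ δ : ℝ, 0 < δ ∧ ∀ r s : ℝ≥0, r ≤ s → s ≤ T → (s : ℝ) - r < δ →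
    (g s - g r) ^ 2 ≤ ε * ((s : ℝ) - r)

/-- The largest dyadic number of level `j` that is at most `s`. -/
noncomputable def dyadicFloor (j : ℕ) (s : ℝ≥0) : ℝ≥0 := (⌊(s : ℝ) * 2 ^ j⌋₊ : ℝ≥0) / 2 ^ j

theorem tendsto_dyadicFloor (s : ℝ≥0) : Tendsto (fun j => dyadicFloor j s) atTop (𝓝 s) := by
  rw [← NNReal.tendsto_coe]
  have h := (tendsto_nat_floor_mul_div_atTop (R := ℝ) s.2).comp
    (tendsto_pow_atTop_atTop_of_one_lt (one_lt_two (α := ℝ)))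
  refine h.congr fun j => ?_
  simp [dyadicFloor, Function.comp]

/-! ### Chaining along dyadic points -/

section Chaining

variable {g : ℝ≥0 → ℝ} {T : ℕ} {M θ : ℝ}

/-- One refinement step moves the dyadic floor by at most one interval of the finer level. -/
theorem abs_sub_dyadicFloor_succ_le (hM : 0 ≤ M) (hθ : 0 < θ)
    (h : ∀ j k : ℕ, k < T * 2 ^ j →
      |g (((k + 1 : ℕ) : ℝ≥0) / 2 ^ j) - g ((k : ℝ≥0) / 2 ^ j)| ≤ M * θ ^ j)
    {s : ℝ≥0} (hs : s < T) (j : ℕ) :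
    |g (dyadicFloor (j + 1) s) - g (dyadicFloor j s)| ≤ M * θ ^ (j + 1) := by
  set a := ⌊(s : ℝ) * 2 ^ j⌋₊ with ha
  set b := ⌊(s : ℝ) * 2 ^ (j + 1)⌋₊ with hb
  have hpow : (0 : ℝ) < 2 ^ j := by positivity
  have ha1 : (a : ℝ) ≤ s * 2 ^ j := Nat.floor_le (by positivity)
  have ha2 : (s : ℝ) * 2 ^ j < a + 1 := Nat.lt_floor_add_one _
  have hb1 : (b : ℝ) ≤ s * 2 ^ (j + 1) := Nat.floor_le (by positivity)
  have hb2 : (s : ℝ) * 2 ^ (j + 1) < b + 1 := Nat.lt_floor_add_one _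
  rw [pow_succ] at hb1 hb2
  have h1 : 2 * a < b + 1 := by
    have : (2 * a : ℝ) < b + 1 := by linarith
    exact_mod_cast this
  have h2 : b < 2 * a + 2 := by
    have : (b : ℝ) < 2 * a + 2 := by linarith
    exact_mod_cast this
  have hda : dyadicFloor j s = ((2 * a : ℕ) : ℝ≥0) / 2 ^ (j + 1) := by
    rw [dyadicFloor, ← ha, pow_succ]
    push_cast
    field_simp
  have hdb : dyadicFloor (j + 1) s = (b : ℝ≥0) / 2 ^ (j + 1) := rfl
  rw [hda, hdb]
  obtain hb3 | hb3 : b = 2 * a ∨ b = 2 * a + 1 := by omega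
  · rw [hb3, sub_self, abs_zero]
    positivity
  · rw [hb3]
    refine h _ _ ?_
    have hs' : (s : ℝ) < T := by exact_mod_cast hs
    have : ((2 * a : ℕ) : ℝ) < ((T * 2 ^ (j + 1) : ℕ) : ℝ) := by
      push_cast
      rw [pow_succ]
      nlinarith
    exact_mod_cast this

/-- The refinement steps form a geometric series, and continuity identifies the limit with `g s`. -/
theorem abs_sub_dyadicFloor_le (hg : Continuous g) (hM : 0 ≤ M) (hθ : 0 < θ) (hθ1 : θ < 1)
    (h : ∀ j k : ℕ, k < T * 2 ^ j →
      |g (((k + 1 : ℕ) : ℝ≥0) / 2 ^ j) - g ((k : ℝ≥0) / 2 ^ j)| ≤ M * θ ^ j)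
    {s : ℝ≥0} (hs : s < T) (j : ℕ) :
    |g (dyadicFloor j s) - g s| ≤ M * θ * θ ^ j / (1 - θ) := by
  refine dist_le_of_le_geometric_of_tendsto θ (M * θ) hθ1 (fun n => ?_)
    ((hg.tendsto s).comp (tendsto_dyadicFloor s)) j
  rw [dist_comm, mul_assoc, ← pow_succ']
  exact abs_sub_dyadicFloor_succ_le hM hθ h hs n

/-- Points at distance at most `2^{-j}` have equal or adjacent floors of level `j`; the triangle
inequality through these floors does the rest. -/
theorem abs_sub_le_of_dyadic (hg : Continuous g) (hM : 0 ≤ M) (hθ : 0 < θ) (hθ1 : θ < 1)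
    (h : ∀ j k : ℕ, k < T * 2 ^ j →
      |g (((k + 1 : ℕ) : ℝ≥0) / 2 ^ j) - g ((k : ℝ≥0) / 2 ^ j)| ≤ M * θ ^ j)
    {r s : ℝ≥0} (hrs : r ≤ s) (hs : s < T) {j : ℕ} (hj : (s : ℝ) - r ≤ (1 / 2) ^ j) :
    |g s - g r| ≤ (2 * (M * θ / (1 - θ)) + M) * θ ^ j := by
  have h1 := abs_sub_dyadicFloor_le hg hM hθ hθ1 h hs j
  have h2 := abs_sub_dyadicFloor_le hg hM hθ hθ1 h (hrs.trans_lt hs) j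
  have h3 : |g (dyadicFloor j s) - g (dyadicFloor j r)| ≤ M * θ ^ j := by
    set a := ⌊(r : ℝ) * 2 ^ j⌋₊ with ha
    set b := ⌊(s : ℝ) * 2 ^ j⌋₊ with hb
    have hpow : (0 : ℝ) < 2 ^ j := by positivity
    have hrs' : (r : ℝ) ≤ s := by exact_mod_cast hrs
    have hj' : ((s : ℝ) - r) * 2 ^ j ≤ 1 := by
      calc ((s : ℝ) - r) * 2 ^ j ≤ (1 / 2) ^ j * 2 ^ j := by gcongr
        _ = 1 := by rw [← mul_pow]; norm_num
    have hab : a ≤ b := Nat.floor_le_floor (by gcongr)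
    have hb1 : (b : ℝ) ≤ s * 2 ^ j := Nat.floor_le (by positivity)
    have ha1 : (a : ℝ) ≤ r * 2 ^ j := Nat.floor_le (by positivity)
    have ha2 : (r : ℝ) * 2 ^ j < a + 1 := Nat.lt_floor_add_one _
    have hba : b < a + 2 := by
      have : (b : ℝ) < a + 2 := by linarith
      exact_mod_cast this
    have hda : dyadicFloor j r = (a : ℝ≥0) / 2 ^ j := rfl
    have hdb : dyadicFloor j s = (b : ℝ≥0) / 2 ^ j := rfl
    rw [hda, hdb]
    obtain hb3 | hb3 : b = a ∨ b = a + 1 := by omega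
    · rw [hb3, sub_self, abs_zero]
      positivity
    · rw [hb3]
      refine h _ _ ?_
      have hs' : (s : ℝ) < T := by exact_mod_cast hs
      have : (a : ℝ) < ((T * 2 ^ j : ℕ) : ℝ) := by
        push_cast
        nlinarith
      exact_mod_cast this
  have h4 : M * θ * θ ^ j / (1 - θ) = M * θ / (1 - θ) * θ ^ j := by ring
  rw [h4] at h1 h2
  rw [abs_le] at *
  constructor <;> nlinarith

/-- At scale `2^{-j}` the squared increment is `O(θ^{2j})`, and `2 θ^2 < 1` makes this negligible
against `2^{-j}`. -/
theorem hasSmallSquaredIncrements_of_dyadic (hg : Continuous g) (hM : 0 ≤ M) (hθ : 0 < θ)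
    (hθ2 : 2 * θ ^ 2 < 1)
    (h : ∀ j k : ℕ, k < T * 2 ^ j →
      |g (((k + 1 : ℕ) : ℝ≥0) / 2 ^ j) - g ((k : ℝ≥0) / 2 ^ j)| ≤ M * θ ^ j)
    {t : ℝ≥0} (ht : t < T) : HasSmallSquaredIncrements g t := by
  intro ε hε
  have hθ1 : θ < 1 := by nlinarith
  set K := 2 * (M * θ / (1 - θ)) + M with hK
  obtain ⟨J, hJ⟩ := (((tendsto_pow_atTop_nhds_zero_of_lt_one (by positivity) hθ2).const_mul
    (2 * K ^ 2)).eventually_le_const (by simpa using hε)).exists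
  refine ⟨(1 / 2) ^ J, by positivity, fun r s hrs hst hlt => ?_⟩
  obtain rfl | hne := hrs.eq_or_lt
  · simp
  have hpos : 0 < (s : ℝ) - r := sub_pos.2 (by exact_mod_cast hne)
  -- The level is fixed by `2^{-(j+1)} < s - r ≤ 2^{-j}`: the upper bound feeds the chaining
  -- estimate, the lower one returns from `2^{-(j+1)}` to `s - r`.
  obtain ⟨j, hj1, hj2⟩ := exists_nat_pow_near_of_lt_one hpos
    (hlt.le.trans (pow_le_one₀ (by norm_num) (by norm_num))) (by norm_num : (0 : ℝ) < 1 / 2)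
    (by norm_num)
  have hJj : J ≤ j := by
    by_contra hlt'
    have : (1 / 2 : ℝ) ^ J ≤ (1 / 2) ^ (j + 1) :=
      pow_le_pow_of_le_one (by norm_num) (by norm_num) (by omega)
    linarith
  have h1 := abs_sub_le_of_dyadic hg hM hθ hθ1 h hrs (hst.trans_lt ht) hj2
  calc (g s - g r) ^ 2 = |g s - g r| ^ 2 := (sq_abs _).symm
    _ ≤ (K * θ ^ j) ^ 2 := by gcongr
    _ = (2 * K ^ 2 * (2 * θ ^ 2) ^ j) * (1 / 2) ^ (j + 1) := by
      rw [mul_pow 2 (θ ^ 2) j, pow_succ, one_div, inv_pow]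
      field_simp
      ring
    _ ≤ ε * ((s : ℝ) - r) := by
      have : 2 * K ^ 2 * (2 * θ ^ 2) ^ j ≤ ε :=
        (mul_le_mul_of_nonneg_left (pow_le_pow_of_le_one (by positivity) hθ2.le hJj)
          (by positivity)).trans hJ
      gcongr

end Chaining

/-! ### Increments of fractional Brownian paths -/

section FractionalBrownianMotion

variable {Ω : Type*} [MeasurableSpace Ω] {P : Measure Ω} {H : ℝ} {B : ℝ≥0 → Ω → ℝ}

theorem IsFractionalBrownianMotion.memLp_two (hB : IsFractionalBrownianMotion P H B) (t : ℝ≥0) :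
    MemLp (B t) 2 P :=
  (hB.gaussian.hasGaussianLaw_eval t).memLp_two

theorem IsFractionalBrownianMotion.integral_sq_sub (hB : IsFractionalBrownianMotion P H B)
    (hH : 0 < H) (s t : ℝ≥0) :
    ∫ ω, (B t ω - B s ω) ^ 2 ∂P = |(t : ℝ) - s| ^ (2 * H) := by
  have hts : Integrable (fun ω => B t ω * B s ω) P := (hB.memLp_two t).integrable_mul (hB.memLp_two s)
  have htt : Integrable (fun ω => B t ω * B t ω) P := (hB.memLp_two t).integrable_mul (hB.memLp_two t)
  have hss : Integrable (fun ω => B s ω * B s ω) P := (hB.memLp_two s).integrable_mul (hB.memLp_two s)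
  have h1 : ∀ ω, (B t ω - B s ω) ^ 2 = B t ω * B t ω - 2 * (B t ω * B s ω) + B s ω * B s ω :=
    fun ω => by ring
  simp_rw [h1]
  have hsub : Integrable (fun ω => B t ω * B t ω - 2 * (B t ω * B s ω)) P :=
    htt.sub (hts.const_mul 2)
  rw [integral_add hsub hss, integral_sub htt (hts.const_mul 2),
    integral_const_mul, hB.covariance, hB.covariance, hB.covariance]
  have h0 : (0 : ℝ) ^ (2 * H) = 0 := Real.zero_rpow (by positivity)
  simp only [sub_self, abs_zero, h0]
  ring

theorem IsFractionalBrownianMotion.ae_zero (hB : IsFractionalBrownianMotion P H B) (hH : 0 < H) :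
    ∀ᵐ ω ∂P, B 0 ω = 0 := by
  have h0 : (0 : ℝ) ^ (2 * H) = 0 := Real.zero_rpow (by positivity)
  have h1 : ∫ ω, B 0 ω * B 0 ω ∂P = 0 := by
    rw [hB.covariance]
    simp [h0]
  have h2 := (integral_eq_zero_iff_of_nonneg (fun ω => mul_self_nonneg (B 0 ω))
    ((hB.memLp_two 0).integrable_mul (hB.memLp_two 0))).1 h1
  filter_upwards [h2] with ω hω
  simpa using hω

/-- The law of an increment of fractional Brownian motion. -/
theorem IsFractionalBrownianMotion.map_sub (hB : IsFractionalBrownianMotion P H B)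
    (hH : 0 < H) (s t : ℝ≥0) :
    P.map (fun ω => B t ω - B s ω) =
      (gaussianReal 0 1).map fun x => |(t : ℝ) - s| ^ H * x := by
  have hG : HasGaussianLaw (fun ω => B t ω - B s ω) P := hB.gaussian.hasGaussianLaw_fun_sub
  have := hG.isProbabilityMeasure
  have hmean : ∫ ω, (B t ω - B s ω) ∂P = 0 := by
    rw [integral_sub ((hB.memLp_two t).integrable one_le_two)
      ((hB.memLp_two s).integrable one_le_two), hB.centered, hB.centered, sub_zero]
  rw [hG.map_eq_gaussianReal, gaussianReal_map_const_mul, hmean,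
    variance_of_integral_eq_zero hG.aemeasurable hmean, hB.integral_sq_sub hH]
  congr 1
  · simp
  · ext
    rw [Real.coe_toNNReal _ (by positivity), mul_one]
    change _ = (|(t : ℝ) - s| ^ H) ^ 2
    rw [← Real.rpow_natCast, ← Real.rpow_mul (abs_nonneg _)]
    congr 1
    push_cast
    ring

theorem lintegral_enorm_pow_gaussianReal_lt_top (r : ℕ) :
    ∫⁻ x, ‖x‖ₑ ^ r ∂(gaussianReal 0 1) < ⊤ := by
  obtain rfl | hr := Nat.eq_zero_or_pos r
  · simp
  have h := memLp_id_gaussianReal (μ := 0) (v := 1) (r : ℝ≥0)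
  have h2 := lintegral_rpow_enorm_lt_top_of_eLpNorm_lt_top (by simpa using hr.ne')
    (by simp) h.2
  simpa using h2

/-- An increment is a standard normal variable scaled by `|t - s|^H`, so all its moments scale
accordingly. -/
theorem IsFractionalBrownianMotion.lintegral_enorm_sub_pow (hB : IsFractionalBrownianMotion P H B)
    (hH : 0 < H) (s t : ℝ≥0) (r : ℕ) :
    ∫⁻ ω, ‖B t ω - B s ω‖ₑ ^ r ∂P =
      ENNReal.ofReal (|(t : ℝ) - s| ^ H) ^ r * ∫⁻ x, ‖x‖ₑ ^ r ∂(gaussianReal 0 1) := by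
  have hG : HasGaussianLaw (fun ω => B t ω - B s ω) P := hB.gaussian.hasGaussianLaw_fun_sub
  have h1 : ∫⁻ ω, ‖B t ω - B s ω‖ₑ ^ r ∂P =
      ∫⁻ x, ‖x‖ₑ ^ r ∂(P.map fun ω => B t ω - B s ω) := by
    rw [lintegral_map' (by fun_prop) hG.aemeasurable]
  rw [h1, hB.map_sub hH, lintegral_map (by fun_prop) (by fun_prop),
    ← lintegral_const_mul _ (by fun_prop)]
  refine lintegral_congr fun x => ?_
  rw [enorm_mul, mul_pow, Real.enorm_of_nonneg (by positivity)]

/-- Almost surely, the increments of fractional Brownian motion over the dyadic intervals of level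
`j` are `O(θ ^ j)` for each `θ > 2 ^ (-H)`. -/
theorem IsFractionalBrownianMotion.ae_dyadic_le (hB : IsFractionalBrownianMotion P H B)
    (hH : 0 < H) {θ : ℝ} (hθ : (1 / 2 : ℝ) ^ H < θ) (T : ℕ) :
    ∀ᵐ ω ∂P, ∃ M : ℝ, 0 ≤ M ∧ ∀ j k : ℕ, k < T * 2 ^ j →
      |B (((k + 1 : ℕ) : ℝ≥0) / 2 ^ j) ω - B ((k : ℝ≥0) / 2 ^ j) ω| ≤ M * θ ^ j := by
  set lam : ℝ := (1 / 2 : ℝ) ^ H with hlam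
  have hlam0 : 0 < lam := by positivity
  have hθ0 : 0 < θ := hlam0.trans hθ
  -- Level `j` has `T 2^j` increments whose `r`-th moments are of order `λ^{jr}`, with `λ = 2^{-H}`.
  -- Divided by `θ^{jr}`, their total is of order `(2 (λ/θ)^r)^j`, which is summable for this large
  -- `r`.
  obtain ⟨r, hr⟩ := (((tendsto_pow_atTop_nhds_zero_of_lt_one (by positivity)
    ((div_lt_one hθ0).2 hθ)).const_mul 2).eventually_lt_const
      (by norm_num : 2 * (0 : ℝ) < 1)).exists
  have hr0 : r ≠ 0 := by
    rintro rfl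
    norm_num at hr
  set C := ∫⁻ x, ‖x‖ₑ ^ r ∂(gaussianReal 0 1) with hC
  have hCtop : C < ⊤ := lintegral_enorm_pow_gaussianReal_lt_top r
  let F : ℕ → Ω → ENNReal := fun j ω => ∑ k ∈ Finset.range (T * 2 ^ j),
    ENNReal.ofReal ((θ⁻¹ ^ j) ^ r) *
      ‖B (((k + 1 : ℕ) : ℝ≥0) / 2 ^ j) ω - B ((k : ℝ≥0) / 2 ^ j) ω‖ₑ ^ r
  have hmeas : ∀ j k : ℕ, AEMeasurable (fun ω =>
      ‖B (((k + 1 : ℕ) : ℝ≥0) / 2 ^ j) ω - B ((k : ℝ≥0) / 2 ^ j) ω‖ₑ ^ r) P := fun j k =>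
    ((hB.gaussian.hasGaussianLaw_fun_sub (s := ((k + 1 : ℕ) : ℝ≥0) / 2 ^ j)
      (t := (k : ℝ≥0) / 2 ^ j)).aemeasurable.enorm).pow_const r
  have hFmeas : ∀ j, AEMeasurable (F j) P := fun j =>
    Finset.aemeasurable_fun_sum _ fun k _ => (hmeas j k).const_mul _
  have hFint : ∀ j, ∫⁻ ω, F j ω ∂P = ENNReal.ofReal (T * (2 * (lam / θ) ^ r) ^ j) * C := by
    intro j
    rw [lintegral_finsetSum' _ fun k _ => (hmeas j k).const_mul _]
    have hk : ∀ k ∈ Finset.range (T * 2 ^ j), ∫⁻ ω, ENNReal.ofReal ((θ⁻¹ ^ j) ^ r) *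
        ‖B (((k + 1 : ℕ) : ℝ≥0) / 2 ^ j) ω - B ((k : ℝ≥0) / 2 ^ j) ω‖ₑ ^ r ∂P =
          ENNReal.ofReal ((θ⁻¹ ^ j) ^ r * (lam ^ j) ^ r) * C := by
      intro k _
      rw [lintegral_const_mul'' _ (hmeas j k), hB.lintegral_enorm_sub_pow hH, ← hC, ← mul_assoc]
      congr 1
      have h1 : |((((k + 1 : ℕ) : ℝ≥0) / 2 ^ j : ℝ≥0) : ℝ) - ((k : ℝ≥0) / 2 ^ j : ℝ≥0)| ^ H =
          lam ^ j := by
        have : ((((k + 1 : ℕ) : ℝ≥0) / 2 ^ j : ℝ≥0) : ℝ) - ((k : ℝ≥0) / 2 ^ j : ℝ≥0) =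
            (1 / 2) ^ j := by
          push_cast
          rw [one_div, inv_pow]
          field_simp
          ring
        rw [this, abs_of_pos (by positivity), hlam, ← Real.rpow_natCast, ← Real.rpow_natCast,
          ← Real.rpow_mul (by norm_num), ← Real.rpow_mul (by norm_num), mul_comm]
      rw [h1, ← ENNReal.ofReal_pow (by positivity), ← ENNReal.ofReal_mul (by positivity)]
    rw [Finset.sum_congr rfl hk, Finset.sum_const, Finset.card_range, nsmul_eq_mul, ← mul_assoc,
      ← ENNReal.ofReal_natCast, ← ENNReal.ofReal_mul (by positivity)]
    congr 2
    push_cast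
    rw [mul_pow 2, ← pow_mul (lam / θ), mul_comm r j, div_pow, ← pow_mul, ← pow_mul, inv_pow]
    field_simp
  have hsum : ∑' j, ∫⁻ ω, F j ω ∂P ≠ ⊤ := by
    simp_rw [hFint]
    rw [ENNReal.tsum_mul_right]
    refine ENNReal.mul_ne_top ?_ hCtop.ne
    exact ((summable_geometric_of_lt_one (by positivity) hr).mul_left (T : ℝ)).tsum_ofReal_ne_top
  rw [← lintegral_tsum hFmeas] at hsum
  -- The total over all levels has finite expectation, so it is almost surely finite; it bounds each
  -- of its terms.
  filter_upwards [ae_lt_top' (AEMeasurable.tsum hFmeas) hsum] with ω hω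
  set S := ∑' j, F j ω with hS
  have hle : ∀ j k : ℕ, k < T * 2 ^ j →
      |B (((k + 1 : ℕ) : ℝ≥0) / 2 ^ j) ω - B ((k : ℝ≥0) / 2 ^ j) ω| ^ r ≤
        S.toReal * (θ ^ j) ^ r := by
    intro j k hk
    set x := B (((k + 1 : ℕ) : ℝ≥0) / 2 ^ j) ω - B ((k : ℝ≥0) / 2 ^ j) ω with hx
    have h1 : ENNReal.ofReal ((θ⁻¹ ^ j) ^ r) * ‖x‖ₑ ^ r ≤ S :=
      (Finset.single_le_sum (f := fun k => ENNReal.ofReal ((θ⁻¹ ^ j) ^ r) *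
        ‖B (((k + 1 : ℕ) : ℝ≥0) / 2 ^ j) ω - B ((k : ℝ≥0) / 2 ^ j) ω‖ₑ ^ r)
        (fun _ _ => zero_le) (Finset.mem_range.2 hk)).trans (ENNReal.le_tsum (f := fun j => F j ω) j)
    have h2 := ENNReal.toReal_mono hω.ne h1
    rw [ENNReal.toReal_mul, ENNReal.toReal_pow, toReal_enorm,
      ENNReal.toReal_ofReal (by positivity), Real.norm_eq_abs] at h2
    calc |x| ^ r = ((θ⁻¹ ^ j) ^ r * |x| ^ r) * (θ ^ j) ^ r := by
          rw [inv_pow, inv_pow]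
          have : (θ ^ j) ^ r ≠ 0 := by positivity
          field_simp
      _ ≤ _ := by gcongr
  -- The bound `S ≤ (1 + S)^r` avoids taking an `r`-th root of `S`.
  refine ⟨1 + S.toReal, by positivity, fun j k hk => ?_⟩
  refine le_of_pow_le_pow_left₀ hr0 (by positivity) ((hle j k hk).trans ?_)
  rw [mul_pow]
  gcongr
  calc S.toReal ≤ 1 + S.toReal := by linarith
    _ ≤ (1 + S.toReal) ^ r := le_self_pow₀ (by linarith [S.toReal_nonneg]) hr0

/-- The paths of fractional Brownian motion with Hurst parameter larger than `1 / 2`. -/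
theorem IsFractionalBrownianMotion.ae_hasSmallSquaredIncrements
    (hB : IsFractionalBrownianMotion P H B) (hH : 1 / 2 < H) :
    ∀ᵐ ω ∂P, ∀ t : ℝ≥0, HasSmallSquaredIncrements (fun s => B s ω) t := by
  -- This is where `H > 1/2` enters: `2^{-H} < 2^{-1/2}` leaves room for a `θ` with `2 θ^2 < 1`.
  have hlam : ((1 / 2 : ℝ) ^ H) < √(1 / 2) := by
    rw [Real.sqrt_eq_rpow]
    exact Real.rpow_lt_rpow_of_exponent_gt (by norm_num) (by norm_num) hH
  obtain ⟨θ, hθ1, hθ2⟩ := exists_between hlam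
  have hθ0 : 0 < θ := lt_trans (by positivity) hθ1
  have hθ3 : 2 * θ ^ 2 < 1 := by
    have : θ ^ 2 < √(1 / 2) ^ 2 := by gcongr
    rw [Real.sq_sqrt (by norm_num)] at this
    linarith
  filter_upwards [hB.continuous_paths,
    ae_all_iff.2 fun T : ℕ => hB.ae_dyadic_le (by linarith) hθ1 T] with ω hc hω t
  obtain ⟨T, hT⟩ := exists_nat_gt t
  obtain ⟨M, hM, h⟩ := hω T
  exact hasSmallSquaredIncrements_of_dyadic hc hM hθ0 hθ3 h hT

end FractionalBrownianMotion

/-! ### Henstock's lemma on uniform partitions -/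

section Henstock

theorem sum_range_mul_blocks {α : Type*} [AddCommMonoid α] (F : ℕ → α) (L N : ℕ) :
    ∑ j ∈ Finset.range (N * L), F j =
      ∑ i ∈ Finset.range N, ∑ r ∈ Finset.range L, F (i * L + r) := by
  induction N with
  | zero => simp
  | succ N ih => rw [Nat.succ_mul, Finset.sum_range_add, ih, Finset.sum_range_succ]

/-- The index map that replaces each index inside a block of length `L` whose number satisfies `A`
by the index of the end of the block. -/
def collapseIndex (A : ℕ → Prop) [DecidablePred A] (L j : ℕ) : ℕ :=
  if A (j / L) ∧ j % L ≠ 0 then (j / L + 1) * L else j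

variable (A : ℕ → Prop) [DecidablePred A] {L : ℕ}

theorem collapseIndex_mul (i : ℕ) : collapseIndex A L (i * L) = i * L := by
  simp [collapseIndex]

theorem collapseIndex_of_not {i r : ℕ} (hA : ¬ A i) (hr : r < L) :
    collapseIndex A L (i * L + r) = i * L + r := by
  have hL : 0 < L := by omega
  have : (i * L + r) / L = i := by
    rw [mul_comm, Nat.mul_add_div hL, Nat.div_eq_of_lt hr, add_zero]
  simp [collapseIndex, this, hA]

theorem collapseIndex_of_pos {i r : ℕ} (hA : A i) (hr : r < L) (hr0 : 0 < r) :
    collapseIndex A L (i * L + r) = (i + 1) * L := by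
  have hL : 0 < L := by omega
  have h1 : (i * L + r) / L = i := by
    rw [mul_comm, Nat.mul_add_div hL, Nat.div_eq_of_lt hr, add_zero]
  have h2 : (i * L + r) % L = r := by
    rw [mul_comm, Nat.mul_add_mod, Nat.mod_eq_of_lt hr]
  simp [collapseIndex, h1, h2, hA, hr0.ne']

theorem collapseIndex_succ_of {i r : ℕ} (hA : A i) (hr : r < L) :
    collapseIndex A L (i * L + r + 1) = (i + 1) * L := by
  obtain h | h : r + 1 < L ∨ r + 1 = L := by omega
  · exact collapseIndex_of_pos A hA h (by omega)
  · have : i * L + r + 1 = (i + 1) * L := by rw [Nat.succ_mul]; omega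
    rw [this, collapseIndex_mul]

theorem collapseIndex_succ_of_not {i r : ℕ} (hA : ¬ A i) (hr : r < L) :
    collapseIndex A L (i * L + r + 1) = i * L + r + 1 := by
  obtain h | h : r + 1 < L ∨ r + 1 = L := by omega
  · exact collapseIndex_of_not A hA h
  · have : i * L + r + 1 = (i + 1) * L := by rw [Nat.succ_mul]; omega
    rw [this, collapseIndex_mul]

/-- These bounds make the collapsed points a partition whose mesh is at most the length of one
block. A collapsed block is crossed in its first step; its other steps have length zero. -/
theorem collapseIndex_le_succ (hL : 0 < L) (j : ℕ) :
    collapseIndex A L j ≤ collapseIndex A L (j + 1) ∧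
      collapseIndex A L (j + 1) ≤ collapseIndex A L j + L := by
  obtain ⟨i, r, hr, rfl⟩ : ∃ i r, r < L ∧ j = i * L + r :=
    ⟨j / L, j % L, Nat.mod_lt _ hL, (Nat.div_add_mod' j L).symm⟩
  by_cases hA : A i
  · rw [collapseIndex_succ_of A hA hr]
    rcases Nat.eq_zero_or_pos r with rfl | hr0
    · rw [add_zero, collapseIndex_mul, Nat.succ_mul]
      omega
    · rw [collapseIndex_of_pos A hA hr hr0]
      omega
  · rw [collapseIndex_succ_of_not A hA hr, collapseIndex_of_not A hA hr]
    omega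

/-- The Riemann-Stieltjes sums of `X` over the uniform partitions tend to the integral. -/
theorem HasRSIntegral.tendsto_uniform {X g : ℝ≥0 → ℝ} {r : ℝ≥0} {I : ℝ}
    (h : HasRSIntegral X g r I) {i : ℕ} {s : ℕ → ℕ → ℝ≥0} {w : ℕ → ℝ} (hw : Tendsto w atTop (𝓝 0))
    (hmono : ∀ L, Monotone (s L)) (h0 : ∀ L, s L 0 = 0) (hend : ∀ L, 0 < L → s L (i * L) = r)
    (hmesh : ∀ L j, (s L (j + 1) : ℝ) - s L j ≤ w L) :
    Tendsto (fun L => ∑ j ∈ Finset.range (i * L), X (s L (j + 1)) * (g (s L (j + 1)) - g (s L j)))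
      atTop (𝓝 I) := by
  rw [Metric.tendsto_nhds]
  intro ε hε
  obtain ⟨δ, hδ, hI⟩ := h ε hε
  filter_upwards [hw.eventually_lt_const hδ, eventually_gt_atTop 0] with L hL hL0
  exact hI (i * L) (s L) (fun j => s L (j + 1)) (hmono L) (h0 L) (hend L hL0)
    (fun j _ => ⟨hmono L j.le_succ, le_rfl⟩) fun j _ => (hmesh L j).trans_lt hL

/-- Henstock's lemma for the Riemann-Stieltjes integral and uniform partitions. -/
theorem HasRSIntegral.sum_abs_le {X g I : ℝ≥0 → ℝ} {t : ℝ≥0}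
    (hI : ∀ r ≤ t, HasRSIntegral X g r (I r)) {ε : ℝ} (hε : 0 < ε) :
    ∃ δ : ℝ, 0 < δ ∧ ∀ N : ℕ, 0 < N → (t : ℝ) / N < δ → ∀ c : ℕ → ℝ≥0, (∀ i, c i = i * t / N) →
      ∑ i ∈ Finset.range N, |I (c (i + 1)) - I (c i) - X (c (i + 1)) * (g (c (i + 1)) - g (c i))|
        ≤ 4 * ε := by
  obtain ⟨δ, hδ, hsum⟩ := hI t le_rfl ε hε
  refine ⟨δ, hδ, fun N hN hNδ c hc => ?_⟩
  have hN' : (N : ℝ) ≠ 0 := by exact_mod_cast hN.ne'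
  -- Each of the `N` intervals is cut into `L` equal parts. The formula also runs beyond `t`, which
  -- keeps it monotone on all indices; `L = 0` gives the zero sequence and is excluded where it
  -- matters.
  set s : ℕ → ℕ → ℝ≥0 := fun L j => j * t / (N * L) with hs
  have hcoe : ∀ L j, (s L j : ℝ) = j * (t / N / L) := fun L j => by
    simp only [hs]; push_cast; rw [div_div, mul_div_assoc]
  have hmono : ∀ L, Monotone (s L) := fun L i j hij => by simp only [hs]; gcongr
  have hs0 : ∀ L, s L 0 = 0 := fun L => by simp [hs]
  have hsblock : ∀ L, 0 < L → ∀ i, s L (i * L) = c i := fun L hL i => by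
    have : (L : ℝ≥0) ≠ 0 := by exact_mod_cast hL.ne'
    rw [hc]
    simp only [hs]
    push_cast
    field_simp
  have hcN : c N = t := by
    have : (N : ℝ≥0) ≠ 0 := by exact_mod_cast hN.ne'
    rw [hc]; field_simp
  have hcle : ∀ i ≤ N, c i ≤ t := fun i hi => by
    rw [← hcN, hc, hc]; gcongr
  have hw : Tendsto (fun L : ℕ => (t : ℝ) / N / L) atTop (𝓝 0) :=
    tendsto_const_div_atTop_nhds_zero_nat _
  let F : ℕ → ℕ → ℝ := fun L j => X (s L (j + 1)) * (g (s L (j + 1)) - g (s L j))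
  -- A block sum is the difference of the sums over `[0, c (i + 1)]` and `[0, c i]`, both of which
  -- converge by hypothesis.
  have hblock : ∀ i < N, Tendsto (fun L => ∑ r ∈ Finset.range L, F L (i * L + r)) atTop
      (𝓝 (I (c (i + 1)) - I (c i))) := by
    intro i hi
    have hlim : ∀ k ≤ N, Tendsto (fun L => ∑ j ∈ Finset.range (k * L), F L j) atTop
        (𝓝 (I (c k))) := fun k hk =>
      (hI _ (hcle k hk)).tendsto_uniform hw hmono hs0 (fun L hL => hsblock L hL k)
        fun L j => by rw [hcoe, hcoe]; push_cast; linarith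
    refine ((hlim (i + 1) hi).sub (hlim i hi.le)).congr fun L => ?_
    rw [Nat.succ_mul, Finset.sum_range_add, add_sub_cancel_left]
  set d : ℕ → ℝ := fun i =>
    I (c (i + 1)) - I (c i) - X (c (i + 1)) * (g (c (i + 1)) - g (c i)) with hd
  -- The fine partition is compared with the one that collapses the blocks in `A`. Both sums lie
  -- within `ε` of `I`, and they differ only on the blocks in `A`; then `L → ∞`.
  have key : ∀ (A : ℕ → Prop) [DecidablePred A],
      |∑ i ∈ Finset.range N, if A i then d i else 0| ≤ 2 * ε := by
    intro A _
    have hlim : Tendsto (fun L => ∑ i ∈ Finset.range N, if A i then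
        (∑ r ∈ Finset.range L, F L (i * L + r)) - X (c (i + 1)) * (g (c (i + 1)) - g (c i)) else 0)
        atTop (𝓝 (∑ i ∈ Finset.range N, if A i then d i else 0)) := by
      refine tendsto_finsetSum _ fun i hi => ?_
      by_cases hA : A i
      · simpa only [hA, if_true] using (hblock i (Finset.mem_range.1 hi)).sub_const _
      · simpa only [hA, if_false] using tendsto_const_nhds
    refine le_of_tendsto hlim.abs ?_
    filter_upwards [eventually_gt_atTop 0] with L hL
    have hL1 : (1 : ℝ) ≤ L := by exact_mod_cast hL
    have hfine := hsum (N * L) (s L) (fun j => s L (j + 1)) (hmono L) (hs0 L)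
      ((hsblock L hL N).trans hcN) (fun j _ => ⟨hmono L j.le_succ, le_rfl⟩) fun j _ => by
        rw [hcoe, hcoe]
        push_cast
        have : (t : ℝ) / N / L ≤ t / N := div_le_self (by positivity) hL1
        linarith
    have hcoarse := hsum (N * L) (fun j => s L (collapseIndex A L j))
      (fun j => s L (collapseIndex A L (j + 1)))
      (monotone_nat_of_le_succ fun j => hmono L (collapseIndex_le_succ A hL j).1)
      (by simpa [hs0] using congrArg (s L) (collapseIndex_mul A (L := L) 0))
      (by rw [collapseIndex_mul, hsblock L hL, hcN])
      (fun j _ => ⟨hmono L (collapseIndex_le_succ A hL j).1, le_rfl⟩) fun j _ => by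
        rw [hcoe, hcoe, ← sub_mul]
        have h1 : (collapseIndex A L (j + 1) : ℝ) ≤ collapseIndex A L j + L := by
          exact_mod_cast (collapseIndex_le_succ A hL j).2
        calc ((collapseIndex A L (j + 1) : ℝ) - collapseIndex A L j) * (t / N / L)
            ≤ L * (t / N / L) := by gcongr; linarith
          _ = t / N := by field_simp
          _ < δ := hNδ
    rw [sum_range_mul_blocks] at hfine hcoarse
    have hinner : ∀ i ∈ Finset.range N, ∑ r ∈ Finset.range L,
        X (s L (collapseIndex A L (i * L + r + 1))) * (g (s L (collapseIndex A L (i * L + r + 1)))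
          - g (s L (collapseIndex A L (i * L + r)))) =
        (∑ r ∈ Finset.range L, F L (i * L + r)) - if A i then
          (∑ r ∈ Finset.range L, F L (i * L + r)) - X (c (i + 1)) * (g (c (i + 1)) - g (c i))
            else 0 := by
      intro i _
      by_cases hA : A i
      · rw [if_pos hA, sub_sub_cancel]
        have h1 : ∀ r ∈ Finset.range L, X (s L (collapseIndex A L (i * L + r + 1))) *
            (g (s L (collapseIndex A L (i * L + r + 1))) - g (s L (collapseIndex A L (i * L + r)))) =
            X (c (i + 1)) * (g (s L (collapseIndex A L (i * L + (r + 1))))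
              - g (s L (collapseIndex A L (i * L + r)))) := fun r hr => by
          rw [← add_assoc, collapseIndex_succ_of A hA (Finset.mem_range.1 hr), hsblock L hL]
        rw [Finset.sum_congr rfl h1, ← Finset.mul_sum,
          Finset.sum_range_sub (fun r => g (s L (collapseIndex A L (i * L + r)))), add_zero,
          ← Nat.succ_mul, collapseIndex_mul, collapseIndex_mul, hsblock L hL, hsblock L hL]
      · rw [if_neg hA, sub_zero]
        refine Finset.sum_congr rfl fun r hr => ?_
        rw [collapseIndex_succ_of_not A hA (Finset.mem_range.1 hr),
          collapseIndex_of_not A hA (Finset.mem_range.1 hr)]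
    rw [Finset.sum_congr rfl hinner, Finset.sum_sub_distrib] at hcoarse
    rw [abs_lt] at hfine hcoarse
    rw [abs_le]
    constructor <;> linarith [hfine.1, hfine.2, hcoarse.1, hcoarse.2]
  -- Splitting by the sign of `d i` turns the bound on partial sums into one on the sum of absolute
  -- values: `2 ε` for each sign.
  have h1 := key fun i => 0 ≤ d i
  have h2 := key fun i => d i < 0
  have h3 : ∑ i ∈ Finset.range N, |d i| = (∑ i ∈ Finset.range N, if 0 ≤ d i then d i else 0) -
      ∑ i ∈ Finset.range N, if d i < 0 then d i else 0 := by
    rw [← Finset.sum_sub_distrib]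
    refine Finset.sum_congr rfl fun i _ => ?_
    rcases le_or_gt 0 (d i) with h | h
    · rw [if_pos h, if_neg h.not_gt, sub_zero, abs_of_nonneg h]
    · rw [if_neg h.not_ge, if_pos h, zero_sub, abs_of_neg h]
  rw [h3]
  rw [abs_le] at h1 h2
  linarith [h1.2, h2.1]

end Henstock

/-! ### Product rules along a path with small squared increments -/

section Calculus

variable {P Q X Y g : ℝ≥0 → ℝ} {b : ℝ → ℝ} {t : ℝ≥0} {C : ℝ}

/-- `P` has along `g` the increments `Q dg`, up to an error of the order of the squared increments
of `g`. -/
def HasQuadraticExpansion (P Q g : ℝ≥0 → ℝ) (t : ℝ≥0) (C : ℝ) : Prop :=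
  ∀ r ≤ t, ∀ s ≤ t, |P s - P r - Q r * (g s - g r)| ≤ C * (g s - g r) ^ 2

theorem intervalIntegrable_comp_toNNReal_mul (hP : Continuous P)
    (hb : IntervalIntegrable b volume 0 t) :
    IntervalIntegrable (fun s => P s.toNNReal * b s) volume 0 t :=
  hb.continuousOn_mul (hP.comp continuous_real_toNNReal).continuousOn

theorem intervalIntegrable_mono_nnreal (hb : IntervalIntegrable b volume 0 t) {r s : ℝ≥0}
    (hr : r ≤ t) (hs : s ≤ t) : IntervalIntegrable b volume r s := by
  refine hb.mono_set (uIcc_subset_uIcc ?_ ?_) <;> rw [uIcc_of_le (NNReal.coe_nonneg t)] <;>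
    exact ⟨NNReal.coe_nonneg _, by exact_mod_cast ‹_›⟩

theorem integral_eq_add_nnreal (hb : IntervalIntegrable b volume 0 t) {r s : ℝ≥0}
    (hr : r ≤ t) (hs : s ≤ t) :
    ∫ x in (0 : ℝ)..s, b x = (∫ x in (0 : ℝ)..r, b x) + ∫ x in (r : ℝ)..s, b x := by
  rw [intervalIntegral.integral_add_adjacent_intervals
    (by simpa using intervalIntegrable_mono_nnreal hb (r := 0) zero_le hr)
    (intervalIntegrable_mono_nnreal hb hr hs)]

theorem exists_modulus (hP : Continuous P) (t : ℝ≥0) {ε : ℝ} (hε : 0 < ε) :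
    ∃ δ : ℝ, 0 < δ ∧ ∀ r ≤ t, ∀ s ≤ t, |(r : ℝ) - s| < δ → |P r - P s| ≤ ε := by
  obtain ⟨δ, hδ, h⟩ := Metric.uniformContinuousOn_iff.1
    ((isCompact_Icc (a := 0) (b := t)).uniformContinuousOn_of_continuous hP.continuousOn) ε hε
  exact ⟨δ, hδ, fun r hr s hs hrs => (h r ⟨zero_le, hr⟩ s ⟨zero_le, hs⟩ hrs).le⟩

theorem abs_const_mul_integral_sub_le (hP : Continuous P) (hb : IntervalIntegrable b volume 0 t)
    {r s : ℝ≥0} (hrs : r ≤ s) (hs : s ≤ t) {p ε : ℝ} (h : ∀ x, r ≤ x → x ≤ s → |p - P x| ≤ ε) :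
    |p * (∫ x in (r : ℝ)..s, b x) - ∫ x in (r : ℝ)..s, P x.toNNReal * b x| ≤
      ε * ∫ x in (r : ℝ)..s, |b x| := by
  have hrs' : (r : ℝ) ≤ s := by exact_mod_cast hrs
  have hb' := intervalIntegrable_mono_nnreal hb (hrs.trans hs) hs
  have hPb := intervalIntegrable_mono_nnreal (intervalIntegrable_comp_toNNReal_mul hP hb)
    (hrs.trans hs) hs
  rw [← intervalIntegral.integral_const_mul, ← intervalIntegral.integral_sub (hb'.const_mul p) hPb,
    ← intervalIntegral.integral_const_mul]
  rw [← Real.norm_eq_abs]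
  refine intervalIntegral.norm_integral_le_of_norm_le hrs' (ae_of_all _ fun x hx => ?_)
    (hb'.abs.const_mul ε)
  rw [← sub_mul, Real.norm_eq_abs, abs_mul]
  refine mul_le_mul_of_nonneg_right (h _ ?_ ?_) (abs_nonneg _)
  · exact NNReal.le_toNNReal_of_coe_le hx.1.le
  · exact Real.toNNReal_le_iff_le_coe.2 hx.2

theorem sum_integral_of_partition (hb : IntervalIntegrable b volume 0 t) {N : ℕ} {π : ℕ → ℝ≥0}
    (hπ : Monotone π) (h0 : π 0 = 0) (hN : π N = t) :
    ∑ i ∈ Finset.range N, ∫ x in (π i : ℝ)..π (i + 1), b x = ∫ x in (0 : ℝ)..t, b x := by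
  rw [intervalIntegral.sum_integral_adjacent_intervals (a := fun i => (π i : ℝ)) fun i hi =>
    intervalIntegrable_mono_nnreal hb (hN ▸ hπ hi.le) (hN ▸ hπ hi)]
  simp only [h0, hN, NNReal.coe_zero]

/-- The increment of `P Y` is `Y(ξ)(P(s) - P(r)) + P(s)(Y(s) - Y(ξ)) + P(r)(Y(ξ) - Y(r))`. Expanding
`P` around the tag `ξ` in both time directions turns the first term into `Q(ξ) Y(ξ)(g(s) - g(r))`;
freezing `P` at `s` and at `r` accounts for the other two. -/
theorem abs_product_increment_le (hP : Continuous P) (hPQ : HasQuadraticExpansion P Q g t C)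
    (hb : IntervalIntegrable b volume 0 t)
    (hY : ∀ r ≤ t, Y r = Y 0 + ∫ x in (0 : ℝ)..r, b x) {K : ℝ} (hK : ∀ r ≤ t, |Y r| ≤ K)
    {r ξ s : ℝ≥0} (hrξ : r ≤ ξ) (hξs : ξ ≤ s) (hs : s ≤ t) {ε : ℝ}
    (hε : ∀ x y, r ≤ x → x ≤ s → r ≤ y → y ≤ s → |P x - P y| ≤ ε) :
    |Q ξ * Y ξ * (g s - g r) - (P s * Y s - P r * Y r - ∫ x in (r : ℝ)..s, P x.toNNReal * b x)| ≤
      K * (C * ((g s - g ξ) ^ 2 + (g ξ - g r) ^ 2)) + ε * ∫ x in (r : ℝ)..s, |b x| := by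
  have hξ : ξ ≤ t := hξs.trans hs
  have hr : r ≤ t := hrξ.trans hξ
  have hPb := intervalIntegrable_comp_toNNReal_mul hP hb
  have hmono {f : ℝ → ℝ} (hf : IntervalIntegrable f volume 0 t) {x y : ℝ≥0} (hx : x ≤ t)
    (hy : y ≤ t) := intervalIntegrable_mono_nnreal hf hx hy
  have hinc : ∀ x ≤ t, ∀ y ≤ t, Y y - Y x = ∫ z in (x : ℝ)..y, b z := fun x hx y hy => by
    rw [hY y hy, hY x hx, integral_eq_add_nnreal hb hx hy]
    ring
  have h1 := abs_const_mul_integral_sub_le hP hb hrξ hξ (p := P r) (ε := ε)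
    fun x hx hx' => hε _ _ le_rfl (hrξ.trans hξs) hx (hx'.trans hξs)
  have h2 := abs_const_mul_integral_sub_le hP hb hξs hs (p := P s) (ε := ε)
    fun x hx hx' => hε _ _ (hrξ.trans hξs) le_rfl (hrξ.trans hx) hx'
  have h3 := hPQ ξ hξ s hs
  have h4 := hPQ ξ hξ r hr
  have h5 := intervalIntegral.integral_add_adjacent_intervals (hmono hPb hr hξ) (hmono hPb hξ hs)
  have h6 := intervalIntegral.integral_add_adjacent_intervals (hmono hb.abs hr hξ) (hmono hb.abs hξ hs)
  rw [← h5, ← h6]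
  have h7 : |Y ξ * (P s - P ξ - Q ξ * (g s - g ξ) - (P r - P ξ - Q ξ * (g r - g ξ)))| ≤
      K * (C * ((g s - g ξ) ^ 2 + (g ξ - g r) ^ 2)) := by
    rw [abs_mul]
    refine mul_le_mul (hK ξ hξ) ?_ (abs_nonneg _) ((abs_nonneg _).trans (hK ξ hξ))
    refine (abs_sub _ _).trans ((add_le_add h3 h4).trans (le_of_eq (by ring)))
  rw [← hinc r hr ξ hξ] at h1
  rw [← hinc ξ hξ s hs] at h2
  calc _ = |-(Y ξ * (P s - P ξ - Q ξ * (g s - g ξ) - (P r - P ξ - Q ξ * (g r - g ξ)))) -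
        ((P r * (Y ξ - Y r) - ∫ x in (r : ℝ)..ξ, P x.toNNReal * b x) +
        (P s * (Y s - Y ξ) - ∫ x in (ξ : ℝ)..s, P x.toNNReal * b x))| := by
        congr 1; ring
    _ ≤ _ := by
        refine (abs_sub _ _).trans (add_le_add ((abs_neg _).trans_le h7) ?_)
        refine (abs_add_le _ _).trans ?_
        rw [mul_add]
        exact add_le_add h1 h2

/-- Integration by parts for the product of a function of `g` and an absolutely continuous
function. -/
theorem hasRSIntegral_of_quadraticExpansion (hP : Continuous P) (hC : 0 ≤ C)
    (hPQ : HasQuadraticExpansion P Q g t C)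
    (hg : HasSmallSquaredIncrements g t) (hb : IntervalIntegrable b volume 0 t)
    (hY : ∀ r ≤ t, Y r = Y 0 + ∫ x in (0 : ℝ)..r, b x) {K : ℝ} (hK : ∀ r ≤ t, |Y r| ≤ K) :
    HasRSIntegral (fun s => Q s * Y s) g t
      (P t * Y t - P 0 * Y 0 - ∫ x in (0 : ℝ)..t, P x.toNNReal * b x) := by
  intro ε hε
  have hK0 : 0 ≤ K := (abs_nonneg _).trans (hK 0 zero_le)
  have hb0 : 0 ≤ ∫ x in (0 : ℝ)..t, |b x| :=
    intervalIntegral.integral_nonneg t.2 fun _ _ => abs_nonneg _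
  set M := K * C * t + ∫ x in (0 : ℝ)..t, |b x| with hM
  have hM0 : 0 ≤ M := by positivity
  -- The local errors will add up to `ε' * M`; the `1` makes the final inequality strict and the
  -- division legitimate.
  set ε' := ε / (M + 1) with hε'
  have hε'0 : 0 < ε' := by positivity
  obtain ⟨δ₁, hδ₁, h1⟩ := hg ε' hε'0
  obtain ⟨δ₂, hδ₂, h2⟩ := exists_modulus hP t hε'0
  refine ⟨min δ₁ δ₂, lt_min hδ₁ hδ₂, fun N π ξ hπ h0 hN hξ hmesh => ?_⟩
  have hle : ∀ i < N, π (i + 1) ≤ t := fun i hi => hN ▸ hπ hi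
  have hlocal : ∀ i ∈ Finset.range N, |Q (ξ i) * Y (ξ i) * (g (π (i + 1)) - g (π i)) -
      (P (π (i + 1)) * Y (π (i + 1)) - P (π i) * Y (π i) -
        ∫ x in (π i : ℝ)..π (i + 1), P x.toNNReal * b x)| ≤
      K * C * (ε' * ((π (i + 1) : ℝ) - π i)) + ε' * ∫ x in (π i : ℝ)..π (i + 1), |b x| := by
    intro i hi
    rw [Finset.mem_range] at hi
    have hm := hmesh i hi
    obtain ⟨hξ1, hξ2⟩ := hξ i hi
    have hξ1' : (π i : ℝ) ≤ ξ i := by exact_mod_cast hξ1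
    have hξ2' : (ξ i : ℝ) ≤ π (i + 1) := by exact_mod_cast hξ2
    have hδ1 := hm.trans_le (min_le_left _ _)
    have hδ2 := hm.trans_le (min_le_right _ _)
    refine (abs_product_increment_le hP hPQ hb hY hK hξ1 hξ2 (hle i hi) (ε := ε') ?_).trans ?_
    · intro x y hx hx' hy hy'
      refine h2 x (hx'.trans (hle i hi)) y (hy'.trans (hle i hi)) ?_
      have e1 : (π i : ℝ) ≤ x := by exact_mod_cast hx
      have e2 : (π i : ℝ) ≤ y := by exact_mod_cast hy
      have e3 : (x : ℝ) ≤ π (i + 1) := by exact_mod_cast hx'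
      have e4 : (y : ℝ) ≤ π (i + 1) := by exact_mod_cast hy'
      rw [abs_lt]
      constructor <;> linarith
    · have e1 := h1 (ξ i) (π (i + 1)) hξ2 (hle i hi) (by linarith)
      have e2 := h1 (π i) (ξ i) hξ1 (hξ2.trans (hle i hi)) (by linarith)
      rw [← mul_assoc]
      have e3 : (g (π (i + 1)) - g (ξ i)) ^ 2 + (g (ξ i) - g (π i)) ^ 2 ≤
          ε' * ((π (i + 1) : ℝ) - π i) := by linarith
      gcongr
  have htel : P t * Y t - P 0 * Y 0 - ∫ x in (0 : ℝ)..t, P x.toNNReal * b x =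
      ∑ i ∈ Finset.range N, (P (π (i + 1)) * Y (π (i + 1)) - P (π i) * Y (π i) -
        ∫ x in (π i : ℝ)..π (i + 1), P x.toNNReal * b x) := by
    rw [Finset.sum_sub_distrib, Finset.sum_range_sub (fun i => P (π i) * Y (π i)), h0, hN,
      sum_integral_of_partition (intervalIntegrable_comp_toNNReal_mul hP hb) hπ h0 hN]
  rw [htel, ← Finset.sum_sub_distrib]
  refine ((Finset.abs_sum_le_sum_abs _ _).trans (Finset.sum_le_sum hlocal)).trans_lt ?_
  rw [Finset.sum_add_distrib, ← Finset.mul_sum, ← Finset.mul_sum, ← Finset.mul_sum,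
    Finset.sum_range_sub (fun i => (π i : ℝ)), h0, hN, sum_integral_of_partition hb.abs hπ h0 hN,
    NNReal.coe_zero, sub_zero]
  calc K * C * (ε' * t) + ε' * ∫ x in (0 : ℝ)..t, |b x| = ε' * M := by rw [hM]; ring
    _ < ε' * (M + 1) := by linarith
    _ = ε := by rw [hε']; field_simp

/-- The product rule that removes a linear multiplicative noise. -/
theorem product_eq_integral_of_linear_noise {I : ℝ≥0 → ℝ} {η : ℝ} (hP : Continuous P) (hC : 0 ≤ C)
    (hPQ : HasQuadraticExpansion P (fun s => -η * P s) g t C)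
    (hg : HasSmallSquaredIncrements g t) (hb : IntervalIntegrable b volume 0 t)
    (hI : ∀ r ≤ t, HasRSIntegral X g r (I r))
    (hX : ∀ r ≤ t, X r = X 0 + (∫ x in (0 : ℝ)..r, b x) + η * I r)
    {K : ℝ} (hK : ∀ r ≤ t, |X r| ≤ K) :
    P t * X t = P 0 * X 0 + ∫ x in (0 : ℝ)..t, P x.toNNReal * b x := by
  have hK0 : 0 ≤ K := (abs_nonneg _).trans (hK 0 zero_le)
  have hb0 : 0 ≤ ∫ x in (0 : ℝ)..t, |b x| :=
    intervalIntegral.integral_nonneg t.2 fun _ _ => abs_nonneg _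
  obtain ⟨R, hR⟩ := (isCompact_Icc (a := 0) (b := t)).exists_bound_of_continuousOn hP.continuousOn
  have hR0 : 0 ≤ R := (norm_nonneg _).trans (hR 0 ⟨le_rfl, zero_le⟩)
  -- The three terms account for the Taylor remainder, the freezing of `P`, and the Henstock errors
  -- with their factor `4`.
  set M := K * C * t + (∫ x in (0 : ℝ)..t, |b x|) + |η| * R * 4 with hM
  have hM0 : 0 ≤ M := by positivity
  have hmain : ∀ ε : ℝ, 0 < ε →
      |P t * X t - P 0 * X 0 - ∫ x in (0 : ℝ)..t, P x.toNNReal * b x| ≤ M * ε := by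
    intro ε hε
    obtain ⟨δ₁, hδ₁, h1⟩ := hg ε hε
    obtain ⟨δ₂, hδ₂, h2⟩ := exists_modulus hP t hε
    obtain ⟨δ₃, hδ₃, h3⟩ := HasRSIntegral.sum_abs_le hI hε
    obtain ⟨N, hNδ, hN⟩ := (((tendsto_const_div_atTop_nhds_zero_nat (t : ℝ)).eventually_lt_const
      (lt_min hδ₁ (lt_min hδ₂ hδ₃))).and (eventually_gt_atTop 0)).exists
    simp only [lt_min_iff] at hNδ
    obtain ⟨hN1, hN2, hN3⟩ := hNδ
    set c : ℕ → ℝ≥0 := fun i => i * t / N with hc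
    have h3' := h3 N hN hN3 c fun i => rfl
    have hcmono : Monotone c := fun i j hij => by simp only [hc]; gcongr
    have hc0 : c 0 = 0 := by simp [hc]
    have hcN : c N = t := by
      have : (N : ℝ≥0) ≠ 0 := by exact_mod_cast hN.ne'
      simp only [hc]; field_simp
    have hcstep : ∀ i, (c (i + 1) : ℝ) - c i = t / N := fun i => by
      simp only [hc]; push_cast; ring
    have hlocal : ∀ i ∈ Finset.range N, |P (c (i + 1)) * X (c (i + 1)) - P (c i) * X (c i) -
        ∫ x in (c i : ℝ)..c (i + 1), P x.toNNReal * b x| ≤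
        K * (C * (ε * ((c (i + 1) : ℝ) - c i))) + ε * (∫ x in (c i : ℝ)..c (i + 1), |b x|) +
          |η| * R * |I (c (i + 1)) - I (c i) - X (c (i + 1)) * (g (c (i + 1)) - g (c i))| := by
      intro i hi
      have hle1 : c (i + 1) ≤ t := hcN ▸ hcmono (Finset.mem_range.1 hi)
      have hle : c i ≤ c (i + 1) := hcmono i.le_succ
      have hle0 : c i ≤ t := hle.trans hle1
      have hinc : X (c (i + 1)) - X (c i) = (∫ x in (c i : ℝ)..c (i + 1), b x) +
          η * (I (c (i + 1)) - I (c i)) := by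
        rw [hX _ hle1, hX _ hle0, integral_eq_add_nnreal hb hle0 hle1]
        ring
      have e1 := abs_const_mul_integral_sub_le hP hb hle hle1 (p := P (c i)) (ε := ε)
        fun x hx hx' => h2 _ hle0 _ (hx'.trans hle1) (by
          have a1 : (c i : ℝ) ≤ x := by exact_mod_cast hx
          have a2 : (x : ℝ) ≤ c (i + 1) := by exact_mod_cast hx'
          have a3 := hcstep i
          rw [abs_lt]
          constructor <;> linarith)
      have e2 := (hPQ _ hle0 _ hle1).trans (mul_le_mul_of_nonneg_left
        (h1 _ _ hle hle1 (by rw [hcstep]; exact hN1)) hC)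
      have e3 : |X (c (i + 1)) * (P (c (i + 1)) - P (c i) -
          -η * P (c i) * (g (c (i + 1)) - g (c i)))| ≤
          K * (C * (ε * ((c (i + 1) : ℝ) - c i))) := by
        rw [abs_mul]
        exact mul_le_mul (hK _ hle1) e2 (abs_nonneg _) hK0
      have e4 : |η * P (c i) * (I (c (i + 1)) - I (c i) -
          X (c (i + 1)) * (g (c (i + 1)) - g (c i)))| ≤
          |η| * R * |I (c (i + 1)) - I (c i) - X (c (i + 1)) * (g (c (i + 1)) - g (c i))| := by
        rw [abs_mul, abs_mul]
        gcongr
        exact hR _ ⟨zero_le, hle0⟩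
      -- In the discrete product rule `P` is taken at the left endpoint, the base point of its
      -- expansion, and `X` at the right endpoint, the tag used in Henstock's lemma. The terms `η P
      -- X dg` then cancel.
      have e5 : P (c (i + 1)) * X (c (i + 1)) - P (c i) * X (c i) -
          (∫ x in (c i : ℝ)..c (i + 1), P x.toNNReal * b x) =
          X (c (i + 1)) * (P (c (i + 1)) - P (c i) - -η * P (c i) * (g (c (i + 1)) - g (c i))) +
          (P (c i) * (∫ x in (c i : ℝ)..c (i + 1), b x) -
            ∫ x in (c i : ℝ)..c (i + 1), P x.toNNReal * b x) +
          η * P (c i) * (I (c (i + 1)) - I (c i) -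
            X (c (i + 1)) * (g (c (i + 1)) - g (c i))) := by
        linear_combination P (c i) * hinc
      rw [e5]
      exact (abs_add_three _ _ _).trans (add_le_add_three e3 e1 e4)
    have htel : P t * X t - P 0 * X 0 - ∫ x in (0 : ℝ)..t, P x.toNNReal * b x =
        ∑ i ∈ Finset.range N, (P (c (i + 1)) * X (c (i + 1)) - P (c i) * X (c i) -
          ∫ x in (c i : ℝ)..c (i + 1), P x.toNNReal * b x) := by
      rw [Finset.sum_sub_distrib, Finset.sum_range_sub (fun i => P (c i) * X (c i)), hc0, hcN,
        sum_integral_of_partition (intervalIntegrable_comp_toNNReal_mul hP hb) hcmono hc0 hcN]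
    rw [htel]
    refine ((Finset.abs_sum_le_sum_abs _ _).trans (Finset.sum_le_sum hlocal)).trans ?_
    rw [Finset.sum_add_distrib, Finset.sum_add_distrib, ← Finset.mul_sum, ← Finset.mul_sum,
      ← Finset.mul_sum, ← Finset.mul_sum, ← Finset.mul_sum,
      Finset.sum_range_sub (fun i => (c i : ℝ)), hc0, hcN,
      sum_integral_of_partition hb.abs hcmono hc0 hcN, NNReal.coe_zero, sub_zero]
    have : |η| * R * ∑ i ∈ Finset.range N,
        |I (c (i + 1)) - I (c i) - X (c (i + 1)) * (g (c (i + 1)) - g (c i))| ≤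
        |η| * R * (4 * ε) := by gcongr
    rw [hM]
    linarith
  have hzero : |P t * X t - P 0 * X 0 - ∫ x in (0 : ℝ)..t, P x.toNNReal * b x| ≤ 0 := by
    refine le_of_forall_pos_le_add fun ε hε => ?_
    refine (hmain (ε / (M + 1)) (by positivity)).trans ?_
    rw [zero_add, mul_div_assoc', div_le_iff₀ (by positivity)]
    nlinarith
  have := abs_eq_zero.1 (le_antisymm hzero (abs_nonneg _))
  linarith

end Calculus

/-! ### Quadratic expansions of exponentials -/

section Exponential

theorem abs_exp_sub_one_sub_le (x : ℝ) :
    |Real.exp x - 1 - x| ≤ x ^ 2 * Real.exp |x| := by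
  have h := Complex.norm_exp_sub_sum_le_norm_mul_exp (x : ℂ) 2
  simp only [Finset.sum_range_succ, Finset.range_zero, Finset.sum_empty, zero_add, pow_zero,
    Nat.factorial, pow_one] at h
  norm_num at h
  rw [← sub_sub] at h
  have e : (Complex.exp x - 1 - x : ℂ) = ((Real.exp x - 1 - x : ℝ) : ℂ) := by push_cast; rfl
  rw [e, Complex.norm_real, Real.norm_eq_abs] at h
  simpa using h

variable {g : ℝ≥0 → ℝ}

/-- Taylor's formula for `exp (c g)`. -/
theorem exists_hasQuadraticExpansion_exp (hg : Continuous g) (c : ℝ) (t : ℝ≥0) :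
    ∃ C, 0 ≤ C ∧ HasQuadraticExpansion (fun s => Real.exp (c * g s))
      (fun s => c * Real.exp (c * g s)) g t C := by
  obtain ⟨R, hR⟩ := (isCompact_Icc (a := 0) (b := t)).exists_bound_of_continuousOn
    (f := fun s => c * g s) (by fun_prop)
  refine ⟨Real.exp R * (c ^ 2 * Real.exp (R + R)), by positivity, fun r hr s hs => ?_⟩
  have h1 := hR r ⟨zero_le, hr⟩
  have h2 := hR s ⟨zero_le, hs⟩
  rw [Real.norm_eq_abs] at h1 h2
  have e : Real.exp (c * g s) - Real.exp (c * g r) - c * Real.exp (c * g r) * (g s - g r) =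
      Real.exp (c * g r) * (Real.exp (c * g s - c * g r) - 1 - (c * g s - c * g r)) := by
    have : Real.exp (c * g s) = Real.exp (c * g r) * Real.exp (c * g s - c * g r) := by
      rw [← Real.exp_add]; congr 1; ring
    rw [this]; ring
  rw [e, abs_mul, Real.abs_exp]
  calc Real.exp (c * g r) * |Real.exp (c * g s - c * g r) - 1 - (c * g s - c * g r)|
      ≤ Real.exp R * ((c * g s - c * g r) ^ 2 * Real.exp (R + R)) := by
        gcongr
        · exact (le_abs_self _).trans h1
        · refine (abs_exp_sub_one_sub_le _).trans ?_
          gcongr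
          exact (abs_sub _ _).trans (add_le_add h2 h1)
    _ = _ := by ring

/-- This replaces `exp (η g) / η` when `η = 0`. -/
theorem hasQuadraticExpansion_self (g : ℝ≥0 → ℝ) (t : ℝ≥0) :
    HasQuadraticExpansion g (fun _ => 1) g t 0 := fun r _ s _ => by simp

theorem HasQuadraticExpansion.div_const {P Q : ℝ≥0 → ℝ} {t : ℝ≥0} {C : ℝ}
    (h : HasQuadraticExpansion P Q g t C) (c : ℝ) :
    HasQuadraticExpansion (fun s => P s / c) (fun s => Q s / c) g t (C / |c|) := by
  intro r hr s hs
  have e : P s / c - P r / c - Q r / c * (g s - g r) = (P s - P r - Q r * (g s - g r)) / c := by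
    ring
  rw [e, abs_div, div_mul_eq_mul_div]
  exact div_le_div_of_nonneg_right (h r hr s hs) (abs_nonneg c)

end Exponential

/-! ### The scalar equation with linear noise -/

/-- Multiplication by `exp (-η g)` removes the noise term from a linear equation driven by `g`. -/
theorem linear_noise_iff {g X : ℝ≥0 → ℝ} {a : ℝ → ℝ} {S : Set ℝ≥0} {η : ℝ}
    (hS : ∀ t ∈ S, Icc 0 t ⊆ S) (hg : Continuous g) (hg2 : ∀ t, HasSmallSquaredIncrements g t)
    (hX : ContinuousOn X S) (ha : ∀ t ∈ S, IntervalIntegrable a volume 0 t) :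
    (∀ t ∈ S, ∃ I, HasRSIntegral X g t I ∧ X t = X 0 + (∫ s in (0 : ℝ)..t, a s) + η * I) ↔
      ∀ t ∈ S, Real.exp (-η * g t) * X t = Real.exp (-η * g 0) * X 0 +
        ∫ s in (0 : ℝ)..t, Real.exp (-η * g s.toNNReal) * a s := by
  have hE : ∀ c : ℝ, Continuous fun s => Real.exp (c * g s) := fun c => by fun_prop
  constructor
  · intro h t ht
    choose! I hI hXI using h
    obtain ⟨K, hK⟩ := isCompact_Icc.exists_bound_of_continuousOn (hX.mono (hS t ht))
    obtain ⟨C, hC, hexp⟩ := exists_hasQuadraticExpansion_exp hg (-η) t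
    exact product_eq_integral_of_linear_noise (hE _) hC hexp (hg2 t) (ha t ht)
      (fun r hr => hI r (hS t ht ⟨zero_le, hr⟩)) (fun r hr => hXI r (hS t ht ⟨zero_le, hr⟩))
      (fun r hr => hK r ⟨zero_le, hr⟩)
  · intro h t ht
    set Y : ℝ≥0 → ℝ := fun s => Real.exp (-η * g s) * X s with hYdef
    obtain ⟨K, hK⟩ := isCompact_Icc.exists_bound_of_continuousOn
      (((hE (-η)).continuousOn.mul hX).mono (hS t ht))
    have hY : ∀ r ≤ t, Y r = Y 0 + ∫ s in (0 : ℝ)..r, Real.exp (-η * g s.toNNReal) * a s :=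
      fun r hr => h r (hS t ht ⟨zero_le, hr⟩)
    have hYK : ∀ r ≤ t, |Y r| ≤ K := fun r hr => hK r ⟨zero_le, hr⟩
    have hb := intervalIntegrable_comp_toNNReal_mul (hE (-η)) (ha t ht)
    -- For `η = 0` the noise term vanishes, but the existence of the integral of `X` still has to be
    -- shown.
    rcases eq_or_ne η 0 with rfl | hη
    · have := hasRSIntegral_of_quadraticExpansion hg le_rfl (hasQuadraticExpansion_self g t)
        (hg2 t) hb hY hYK
      have hYX : (fun s => 1 * Y s) = X := by ext s; simp [hYdef]
      rw [hYX] at this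
      exact ⟨_, this, by simpa [hYdef] using hY t le_rfl⟩
    · obtain ⟨C, hC, hexp⟩ := exists_hasQuadraticExpansion_exp hg η t
      have := hasRSIntegral_of_quadraticExpansion (by fun_prop) (by positivity)
        (hexp.div_const η) (hg2 t) hb hY hYK
      have hcancel : ∀ s, Real.exp (η * g s) * Real.exp (-η * g s) = 1 := fun s => by
        rw [← Real.exp_add]; simp
      have hYX : (fun s => η * Real.exp (η * g s) / η * Y s) = X := by
        ext s
        rw [mul_div_cancel_left₀ _ hη, hYdef, ← mul_assoc, hcancel, one_mul]
      have hPY : ∀ s, Real.exp (η * g s) / η * Y s = X s / η := fun s => by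
        rw [hYdef, div_mul_eq_mul_div, ← mul_assoc, hcancel, one_mul]
      have hint : ∀ s : ℝ, Real.exp (η * g s.toNNReal) / η *
          (Real.exp (-η * g s.toNNReal) * a s) = η⁻¹ * a s := fun s => by
        rw [div_mul_eq_mul_div, ← mul_assoc, hcancel, one_mul, div_eq_inv_mul]
      -- The integral is now `(X t - X 0 - ∫ a) / η`, which is the equation solved for `I`.
      rw [hYX, hPY, hPY] at this
      simp only [hint] at this
      rw [intervalIntegral.integral_const_mul] at this
      refine ⟨_, this, ?_⟩
      field_simp
      ring

theorem timeIntegral_congr {F G : ℝ≥0 → ℝ} {t : ℝ≥0} (h : ∀ s ≤ t, F s = G s) :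
    timeIntegral F t = timeIntegral G t := by
  refine intervalIntegral.integral_congr fun s hs => h _ ?_
  rw [uIcc_of_le (NNReal.coe_nonneg t)] at hs
  exact Real.toNNReal_le_iff_le_coe.2 hs.2

theorem intervalIntegrable_comp_toNNReal {F : ℝ≥0 → ℝ} {t : ℝ≥0} (hF : ContinuousOn F (Icc 0 t)) :
    IntervalIntegrable (fun s => F s.toNNReal) volume 0 t := by
  refine ContinuousOn.intervalIntegrable (hF.comp continuous_real_toNNReal.continuousOn ?_)
  intro s hs
  rw [uIcc_of_le (NNReal.coe_nonneg t)] at hs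
  exact ⟨zero_le, Real.toNNReal_le_iff_le_coe.2 hs.2⟩

/-! ### Time regularity of spatial integrals -/

section Space

variable {d : ℕ} {D : Set (Space d)} {φ : Space d → ℝ}

theorem IsTestFunction.continuous_laplacian (hφ : IsTestFunction D φ) :
    Continuous (Laplacian.laplacian φ) := by
  rw [InnerProductSpace.laplacian_eq_iteratedFDeriv_stdOrthonormalBasis]
  have : Continuous (iteratedFDeriv ℝ 2 φ) :=
    (contDiff_infty.1 hφ.smooth 2).continuous_iteratedFDeriv le_rfl
  fun_prop

theorem laplacian_eq_zero_of_notMem_tsupport {x : Space d} (hx : x ∉ tsupport φ) :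
    Laplacian.laplacian φ x = 0 := by
  have h : φ =ᶠ[𝓝 x] fun _ => (0 : ℝ) := notMem_tsupport_iff_eventuallyEq.1 hx
  rw [(InnerProductSpace.laplacian_congr_nhds h).eq_of_nhds]
  simp

theorem continuousOn_setIntegral_mul (hD : IsOpen D) {S : Set ℝ≥0} {w : ℝ≥0 → Space d → ℝ}
    (hw : ContinuousOn (fun z : ℝ≥0 × Space d => w z.1 z.2) (S ×ˢ D)) {K : Set (Space d)}
    (hK : IsCompact K) (hKD : K ⊆ D) {ψ : Space d → ℝ} (hψ : Continuous ψ)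
    (hψK : ∀ x ∉ K, ψ x = 0) :
    ContinuousOn (fun s => ∫ x in D, w s x * ψ x) S := by
  refine continuousOn_integral_of_compact_support hK ?_ fun s x _ hx => by rw [hψK x hx, mul_zero]
  rintro ⟨s, x⟩ ⟨hs, -⟩
  -- Nothing is known about `w` outside `D`, but there the product vanishes in a neighbourhood,
  -- because `K` is closed and contained in `D`.
  by_cases hx : x ∈ D
  · have h1 : ContinuousWithinAt (fun z : ℝ≥0 × Space d => w z.1 z.2 * ψ z.2) (S ×ˢ D) (s, x) :=
      (hw (s, x) ⟨hs, hx⟩).mul (by fun_prop : Continuous fun z : ℝ≥0 × Space d =>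
        ψ z.2).continuousWithinAt
    refine h1.mono_of_mem_nhdsWithin ?_
    rw [nhdsWithin_prod_eq, nhdsWithin_univ]
    exact prod_mem_prod self_mem_nhdsWithin (hD.mem_nhds hx)
  · have hxK : Kᶜ ∈ 𝓝 x := hK.isClosed.isOpen_compl.mem_nhds fun h => hx (hKD h)
    have h0 : (fun z : ℝ≥0 × Space d => w z.1 z.2 * ψ z.2) =ᶠ[𝓝 (s, x)] fun _ => 0 := by
      filter_upwards [continuous_snd.continuousAt.preimage_mem_nhds hxK] with z hz
      rw [hψK _ hz, mul_zero]
    exact (continuousAt_const.congr h0.symm).continuousWithinAt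

/-- The non-local terms contain no compactly supported factor, so their integrability in time comes
from Fubini's theorem instead of continuity. -/
theorem intervalIntegrable_setIntegral {F : ℝ≥0 → Space d → ℝ} {t : ℝ≥0}
    (hF : IntegrableOn (fun z : ℝ × Space d => F z.1.toNNReal z.2) (Ioc (0 : ℝ) t ×ˢ D)) :
    IntervalIntegrable (fun s => ∫ y in D, F s.toNNReal y) volume 0 t := by
  rw [intervalIntegrable_iff_integrableOn_Ioc_of_le (NNReal.coe_nonneg t)]
  rw [IntegrableOn, Measure.volume_eq_prod, ← Measure.prod_restrict] at hF
  exact hF.integral_prod_left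

end Space

/-! ### Integrability and splitting of the drift -/

section Drift

variable {d : ℕ} (D : Set (Space d)) (k γ δ p q m n : ℝ) (φ : Space d → ℝ)

/-- The drift of the equation, tested with `φ`. -/
noncomputable def drift (w : ℝ≥0 → Space d → ℝ) (s : ℝ≥0) : ℝ :=
  (∫ x in D, w s x * (Laplacian.laplacian φ x + γ * φ x))
    + (∫ y in D, w s y ^ q) * (∫ z in D, φ z)
    - k * (∫ x in D, w s x ^ p * φ x)
    + δ * ((∫ x in D, w s x ^ m * φ x) * ∫ y in D, w s y ^ n)

/-- The regularity of the paths of a solution that makes the terms of the drift integrable in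
time. -/
structure IsRegularPath (S : Set ℝ≥0) (w : ℝ≥0 → Space d → ℝ) : Prop where
  continuousOn : ContinuousOn (fun z : ℝ≥0 × Space d => w z.1 z.2) (S ×ˢ D)
  nonneg : ∀ t ∈ S, ∀ x ∈ D, 0 ≤ w t x
  integrable_q : ∀ t ∈ S,
    IntegrableOn (fun z : ℝ × Space d => w z.1.toNNReal z.2 ^ q) (Ioc (0 : ℝ) t ×ˢ D)
  integrable_n : ∀ t ∈ S,
    IntegrableOn (fun z : ℝ × Space d => w z.1.toNNReal z.2 ^ n) (Ioc (0 : ℝ) t ×ˢ D)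

variable {D k γ δ p q m n φ} {S : Set ℝ≥0} {w : ℝ≥0 → Space d → ℝ} {t : ℝ≥0} {E : ℝ≥0 → ℝ}

theorem IsRegularPath.continuousOn_test (hw : IsRegularPath D q n S w) (hD : IsOpen D)
    (hφ : IsTestFunction D φ) : ContinuousOn (fun s => ∫ x in D, w s x * φ x) S :=
  continuousOn_setIntegral_mul hD hw.continuousOn hφ.compact hφ.support hφ.smooth.continuous
    fun _ => image_eq_zero_of_notMem_tsupport

theorem IsRegularPath.continuousOn_rpow_test (hw : IsRegularPath D q n S w) (hD : IsOpen D)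
    (hφ : IsTestFunction D φ) {r : ℝ} (hr : 0 ≤ r) :
    ContinuousOn (fun s => ∫ x in D, w s x ^ r * φ x) S :=
  continuousOn_setIntegral_mul (w := fun s x => w s x ^ r) hD
    (hw.continuousOn.rpow_const fun _ _ => Or.inr hr) hφ.compact
    hφ.support hφ.smooth.continuous fun _ => image_eq_zero_of_notMem_tsupport

theorem IsRegularPath.continuousOn_laplacian (hw : IsRegularPath D q n S w) (hD : IsOpen D)
    (hφ : IsTestFunction D φ) :
    ContinuousOn (fun s => ∫ x in D, w s x * (Laplacian.laplacian φ x + γ * φ x)) S :=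
  continuousOn_setIntegral_mul hD hw.continuousOn hφ.compact hφ.support
    (hφ.continuous_laplacian.add (hφ.smooth.continuous.const_mul γ)) fun x hx => by
      rw [laplacian_eq_zero_of_notMem_tsupport hx, image_eq_zero_of_notMem_tsupport hx]
      simp

/-- The weight `E` serves both equations: `E = 1` for the stochastic one, `E = exp (-η g)` for the
random one. -/
theorem IsRegularPath.timeIntegral_mul_drift (hw : IsRegularPath D q n S w) (hD : IsOpen D)
    (hφ : IsTestFunction D φ) (hp : 0 ≤ p) (hm : 0 ≤ m) (hE : Continuous E) (ht : t ∈ S)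
    (hS : Icc 0 t ⊆ S) :
    IntervalIntegrable (fun s => drift D k γ δ p q m n φ w s.toNNReal) volume 0 t ∧
    timeIntegral (fun s => E s * drift D k γ δ p q m n φ w s) t =
      timeIntegral (fun s => E s * ∫ x in D, w s x * (Laplacian.laplacian φ x + γ * φ x)) t
      + timeIntegral (fun s => E s * ((∫ y in D, w s y ^ q) * ∫ z in D, φ z)) t
      - k * timeIntegral (fun s => E s * ∫ x in D, w s x ^ p * φ x) t
      + δ * timeIntegral
          (fun s => E s * ((∫ x in D, w s x ^ m * φ x) * ∫ y in D, w s y ^ n)) t := by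
  have h1 := intervalIntegrable_comp_toNNReal
    ((hw.continuousOn_laplacian (γ := γ) hD hφ).mono hS)
  have h2 := (intervalIntegrable_setIntegral (F := fun s y => w s y ^ q)
    (hw.integrable_q t ht)).mul_const (∫ z in D, φ z)
  have h3 := intervalIntegrable_comp_toNNReal ((hw.continuousOn_rpow_test hD hφ hp).mono hS)
  have h4 : IntervalIntegrable (fun s : ℝ => (∫ x in D, w s.toNNReal x ^ m * φ x) *
      ∫ y in D, w s.toNNReal y ^ n) volume 0 t := by
    refine (intervalIntegrable_setIntegral (F := fun s y => w s y ^ n)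
      (hw.integrable_n t ht)).continuousOn_mul ?_
    refine ((hw.continuousOn_rpow_test hD hφ hm).mono hS).comp
      continuous_real_toNNReal.continuousOn fun s hs => ?_
    rw [uIcc_of_le (NNReal.coe_nonneg t)] at hs
    exact ⟨zero_le, Real.toNNReal_le_iff_le_coe.2 hs.2⟩
  refine ⟨((h1.add h2).sub (h3.const_mul k)).add (h4.const_mul δ), ?_⟩
  have e1 := intervalIntegrable_comp_toNNReal_mul hE h1
  have e2 := intervalIntegrable_comp_toNNReal_mul hE h2
  have e3 := intervalIntegrable_comp_toNNReal_mul hE h3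
  have e4 := intervalIntegrable_comp_toNNReal_mul hE h4
  simp only [timeIntegral]
  rw [← intervalIntegral.integral_const_mul, ← intervalIntegral.integral_const_mul,
    ← intervalIntegral.integral_add e1 e2,
    ← intervalIntegral.integral_sub (e1.add e2) (e3.const_mul k),
    ← intervalIntegral.integral_add ((e1.add e2).sub (e3.const_mul k)) (e4.const_mul δ)]
  refine intervalIntegral.integral_congr fun s _ => ?_
  simp only [drift]
  ring

end Drift

/-! ### Invariance of the field conditions under the exponential factor -/

section Field

variable {Ω : Type*} [MeasurableSpace Ω] {P : Measure Ω} {𝓕 : Filtration ℝ≥0 ‹MeasurableSpace Ω›}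
  {B : ℝ≥0 → Ω → ℝ} {τ : Ω → WithTop ℝ≥0} {d : ℕ} {D : Set (Space d)} {f : Space d → ℝ} {q n : ℝ}
  {u : ℝ≥0 → Space d → Ω → ℝ}

theorem Icc_subset_of_lt {t : ℝ≥0} {σ : WithTop ℝ≥0} (ht : (t : WithTop ℝ≥0) < σ) :
    Icc 0 t ⊆ {s : ℝ≥0 | (s : WithTop ℝ≥0) < σ} := fun _ hs =>
  lt_of_le_of_lt (WithTop.coe_le_coe.2 hs.2) ht

theorem IsSolutionField.ae_isRegularPath (hu : IsSolutionField P 𝓕 τ D f q n u) :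
    ∀ᵐ ω ∂P, IsRegularPath D q n {t : ℝ≥0 | (t : WithTop ℝ≥0) < τ ω} fun t x => u t x ω := by
  filter_upwards [hu.continuous, hu.nonneg, hu.integrable_q, hu.integrable_n] with ω h1 h2 h3 h4
  exact ⟨h1, h2, h3, h4⟩

theorem integrableOn_rpow_mul (hD : IsOpen D) {E : ℝ≥0 → ℝ} (hE : Continuous E)
    (hE0 : ∀ s, 0 ≤ E s) {w : ℝ≥0 → Space d → ℝ} {t : ℝ≥0} {r : ℝ} (hr : 0 ≤ r)
    (hw0 : ∀ s ≤ t, ∀ x ∈ D, 0 ≤ w s x)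
    (hw : IntegrableOn (fun z : ℝ × Space d => w z.1.toNNReal z.2 ^ r) (Ioc (0 : ℝ) t ×ˢ D)) :
    IntegrableOn (fun z : ℝ × Space d => (E z.1.toNNReal * w z.1.toNNReal z.2) ^ r)
      (Ioc (0 : ℝ) t ×ˢ D) := by
  have hmeas : MeasurableSet (Ioc (0 : ℝ) t ×ˢ D) := measurableSet_Ioc.prod hD.measurableSet
  have hcont : Continuous fun z : ℝ × Space d => E z.1.toNNReal ^ r :=
    ((hE.comp (continuous_real_toNNReal.comp continuous_fst))).rpow_const fun _ => Or.inr hr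
  obtain ⟨R, hR⟩ := (isCompact_Icc (a := 0) (b := t)).exists_bound_of_continuousOn
    (hE.rpow_const fun _ => Or.inr hr).continuousOn
  have hle : ∀ z ∈ Ioc (0 : ℝ) t ×ˢ D, z.1.toNNReal ≤ t := fun z hz =>
    Real.toNNReal_le_iff_le_coe.2 hz.1.2
  have h1 : IntegrableOn (fun z : ℝ × Space d => E z.1.toNNReal ^ r * w z.1.toNNReal z.2 ^ r)
      (Ioc (0 : ℝ) t ×ˢ D) :=
    Integrable.bdd_mul (c := R) hw hcont.aestronglyMeasurable <|
      (ae_restrict_iff' hmeas).2 <| ae_of_all _ fun z hz => hR _ ⟨zero_le, hle z hz⟩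
  refine h1.congr_fun (fun z hz => ?_) hmeas
  exact (Real.mul_rpow (hE0 _) (hw0 _ (hle z hz) _ hz.2)).symm

/-- The factor is adapted, positive and continuous in time, hence bounded on `[0, t]`; it leaves the
initial value unchanged because `B 0 = 0` almost surely. -/
theorem IsSolutionField.exp_mul (hu : IsSolutionField P 𝓕 τ D f q n u) (hD : IsOpen D)
    (hq : 0 ≤ q) (hn : 0 ≤ n) (hBc : ∀ᵐ ω ∂P, Continuous fun t => B t ω)
    (hB0 : ∀ᵐ ω ∂P, B 0 ω = 0) (hB : StronglyAdapted 𝓕 B) (c : ℝ) :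
    IsSolutionField P 𝓕 τ D f q n fun t x ω => Real.exp (c * B t ω) * u t x ω where
  adapted x hx t := (Real.continuous_exp.comp_stronglyMeasurable
    (stronglyMeasurable_const.mul (hB t))).mul (hu.adapted x hx t)
  continuous := by
    filter_upwards [hu.continuous, hBc] with ω h hc
    exact ContinuousOn.mul (by fun_prop) h
  nonneg := by
    filter_upwards [hu.nonneg] with ω h t ht x hx
    exact mul_nonneg (Real.exp_nonneg _) (h t ht x hx)
  initial := by
    filter_upwards [hu.initial, hB0] with ω h h0 x hx
    simp [h0, h x hx]
  boundary := by
    filter_upwards [hu.boundary] with ω h t ht ht' x hx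
    simpa using (h t ht ht' x hx).const_mul (Real.exp (c * B t ω))
  integrable_q := by
    filter_upwards [hu.integrable_q, hu.nonneg, hBc] with ω h h0 hc t ht
    exact integrableOn_rpow_mul (E := fun s => Real.exp (c * B s ω))
      (w := fun s x => u s x ω) hD (by fun_prop) (fun _ => Real.exp_nonneg _) hq
      (fun s hs => h0 s (Icc_subset_of_lt ht ⟨zero_le, hs⟩)) (h t ht)
  integrable_n := by
    filter_upwards [hu.integrable_n, hu.nonneg, hBc] with ω h h0 hc t ht
    exact integrableOn_rpow_mul (E := fun s => Real.exp (c * B s ω))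
      (w := fun s x => u s x ω) hD (by fun_prop) (fun _ => Real.exp_nonneg _) hn
      (fun s hs => h0 s (Icc_subset_of_lt ht ⟨zero_le, hs⟩)) (h t ht)

end Field

/-! ### Equivalence of the tested equations -/

section Equation

variable {d : ℕ} {D : Set (Space d)} {φ : Space d → ℝ} {w : Space d → ℝ}

theorem setIntegral_mul_mul (e : ℝ) (ψ : Space d → ℝ) :
    ∫ x in D, e * w x * ψ x = e * ∫ x in D, w x * ψ x := by
  simp_rw [mul_assoc]
  exact integral_const_mul _ _

theorem setIntegral_exp_mul_rpow (hD : IsOpen D) (hw : ∀ x ∈ D, 0 ≤ w x) (y r : ℝ)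
    (ψ : Space d → ℝ) :
    ∫ x in D, (Real.exp y * w x) ^ r * ψ x = Real.exp (y * r) * ∫ x in D, w x ^ r * ψ x := by
  rw [← integral_const_mul]
  refine setIntegral_congr_fun hD.measurableSet fun x hx => ?_
  change (Real.exp y * w x) ^ r * ψ x = Real.exp (y * r) * (w x ^ r * ψ x)
  rw [Real.mul_rpow (Real.exp_nonneg _) (hw x hx), Real.exp_mul, mul_assoc]

/-- For a regular path, the tested stochastic equation and the tested random equation are
equivalent. -/
theorem tested_equation_iff {g : ℝ≥0 → ℝ} {S : Set ℝ≥0} {k γ δ η p q m n : ℝ}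
    {w : ℝ≥0 → Space d → ℝ} (hD : IsOpen D) (hφ : IsTestFunction D φ)
    (hw : IsRegularPath D q n S w) (hp : 0 ≤ p) (hm : 0 ≤ m)
    (hS : ∀ t ∈ S, Icc 0 t ⊆ S) (hg : Continuous g) (hg2 : ∀ t, HasSmallSquaredIncrements g t) :
    (∀ t ∈ S, ∃ I : ℝ, HasRSIntegral (fun s => ∫ x in D, w s x * φ x) g t I ∧
      ∫ x in D, w t x * φ x =
        (∫ x in D, w 0 x * φ x)
        + timeIntegral (fun s => ∫ x in D, w s x * (Laplacian.laplacian φ x + γ * φ x)) t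
        + timeIntegral (fun s => (∫ y in D, w s y ^ q) * ∫ z in D, φ z) t
        - k * timeIntegral (fun s => ∫ x in D, w s x ^ p * φ x) t
        + δ * timeIntegral (fun s => (∫ x in D, w s x ^ m * φ x) * ∫ y in D, w s y ^ n) t
        + η * I) ↔
    ∀ t ∈ S, ∫ x in D, Real.exp (-η * g t) * w t x * φ x =
      (∫ x in D, Real.exp (-η * g 0) * w 0 x * φ x)
      + timeIntegral (fun s => ∫ x in D,
          Real.exp (-η * g s) * w s x * (Laplacian.laplacian φ x + γ * φ x)) t
      + timeIntegral (fun s => Real.exp ((q - 1) * η * g s) *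
          ((∫ y in D, (Real.exp (-η * g s) * w s y) ^ q) * ∫ z in D, φ z)) t
      - k * timeIntegral (fun s => Real.exp ((p - 1) * η * g s) *
          ∫ x in D, (Real.exp (-η * g s) * w s x) ^ p * φ x) t
      + δ * timeIntegral (fun s => Real.exp ((m + n - 1) * η * g s) *
          ((∫ x in D, (Real.exp (-η * g s) * w s x) ^ m * φ x) *
            ∫ y in D, (Real.exp (-η * g s) * w s y) ^ n)) t := by
  have hE : Continuous fun s => Real.exp (-η * g s) := by fun_prop
  have hdrift := fun t ht => hw.timeIntegral_mul_drift (k := k) (γ := γ) (δ := δ) hD hφ hp hm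
    hE (t := t) ht (hS t ht)
  have hdrift1 := fun t ht => (hw.timeIntegral_mul_drift (k := k) (γ := γ) (δ := δ) hD hφ hp hm
    (continuous_const (y := (1 : ℝ))) (t := t) ht (hS t ht)).2
  simp only [one_mul] at hdrift1
  have key := linear_noise_iff (η := η) hS hg hg2 (hw.continuousOn_test hD hφ)
    fun t ht => (hdrift t ht).1
  refine Iff.trans ?_ (key.trans ?_)
  · refine forall₂_congr fun t ht => exists_congr fun I => and_congr_right fun _ => ?_
    have := hdrift1 t ht
    rw [timeIntegral] at this
    rw [this]
    simp only [← add_assoc, add_sub_assoc]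
  · refine forall₂_congr fun t ht => ?_
    have hnn : ∀ s ≤ t, ∀ x ∈ D, 0 ≤ w s x := fun s hs => hw.nonneg s (hS t ht ⟨zero_le, hs⟩)
    -- The case of the constant test weight `1`, needed for the non-local factors.
    have hone : ∀ s ≤ t, ∀ r, ∫ y in D, (Real.exp (-η * g s) * w s y) ^ r =
        Real.exp (-η * g s * r) * ∫ y in D, w s y ^ r := fun s hs r => by
      simpa using setIntegral_exp_mul_rpow hD (hnn s hs) (-η * g s) r fun _ => 1
    -- The exponents add up: `(q - 1) η g - q η g = -η g`. The same count with `p` and with `m + n`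
    -- settles the other two terms.
    have e2 := timeIntegral_congr (t := t) (F := fun s => Real.exp ((q - 1) * η * g s) *
          ((∫ y in D, (Real.exp (-η * g s) * w s y) ^ q) * ∫ z in D, φ z))
        (G := fun s => Real.exp (-η * g s) * ((∫ y in D, w s y ^ q) * ∫ z in D, φ z))
        fun s hs => by
      have : Real.exp (-η * g s) = Real.exp ((q - 1) * η * g s) * Real.exp (-η * g s * q) := by
        rw [← Real.exp_add]; ring_nf
      rw [hone s hs, this]
      ring
    have e3 := timeIntegral_congr (t := t) (F := fun s => Real.exp ((p - 1) * η * g s) *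
          ∫ x in D, (Real.exp (-η * g s) * w s x) ^ p * φ x)
        (G := fun s => Real.exp (-η * g s) * ∫ x in D, w s x ^ p * φ x)
        fun s hs => by
      have : Real.exp (-η * g s) = Real.exp ((p - 1) * η * g s) * Real.exp (-η * g s * p) := by
        rw [← Real.exp_add]; ring_nf
      rw [setIntegral_exp_mul_rpow hD (hnn s hs), this]
      ring
    have e4 := timeIntegral_congr (t := t) (F := fun s => Real.exp ((m + n - 1) * η * g s) *
          ((∫ x in D, (Real.exp (-η * g s) * w s x) ^ m * φ x) *
            ∫ y in D, (Real.exp (-η * g s) * w s y) ^ n))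
        (G := fun s => Real.exp (-η * g s) *
          ((∫ x in D, w s x ^ m * φ x) * ∫ y in D, w s y ^ n))
        fun s hs => by
      have : Real.exp (-η * g s) = Real.exp ((m + n - 1) * η * g s) *
          Real.exp (-η * g s * m) * Real.exp (-η * g s * n) := by
        rw [← Real.exp_add, ← Real.exp_add]; ring_nf
      rw [hone s hs, setIntegral_exp_mul_rpow hD (hnn s hs), this]
      ring
    have h := (hdrift t ht).2
    rw [timeIntegral] at h
    rw [h, e2, e3, e4]
    simp only [setIntegral_mul_mul, ← add_assoc, add_sub_assoc]

end Equation

end NonlocalSPDE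

/-! ### The equivalence for random fields -/

theorem theorem3p1 {Ω : Type*} [MeasurableSpace Ω] (P : Measure Ω) [IsProbabilityMeasure P]
    (𝓕 : Filtration ℝ≥0 ‹MeasurableSpace Ω›)
    (H : ℝ) (hH : 1 / 2 < H) (hH1 : H < 1)
    (B : ℝ≥0 → Ω → ℝ) (hB : NonlocalSPDE.IsFractionalBrownianMotion P H B)
    (hB_adapted : StronglyAdapted 𝓕 B)
    (τ : Ω → WithTop ℝ≥0) (hτ : IsStoppingTime 𝓕 τ)
    (d : ℕ) (hd : 1 ≤ d) (D : Set (NonlocalSPDE.Space d))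
    (hD_open : IsOpen D) (hD_conn : IsConnected D) (hD_bdd : Bornology.IsBounded D)
    (hD_smooth : NonlocalSPDE.HasSmoothBoundary D)
    (k γ δ η p q m n : ℝ) (hk : 0 < k) (hγ : 0 ≤ γ) (hδ : 0 ≤ δ) (hη : 0 ≤ η)
    (hp : 1 < p) (hq : 1 < q) (hn : 1 < n) (hm : 0 ≤ m) (hqp : p ≤ q) (hmnq : q ≤ m + n)
    (f : NonlocalSPDE.Space d → ℝ) (hf_smooth : ContDiffOn ℝ 2 f D) (hf_nonneg : ∀ x ∈ D, 0 ≤ f x)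
    (hf_bdd : ∃ M : ℝ, ∀ x ∈ D, f x ≤ M) (hf_ne : ∃ x ∈ D, f x ≠ 0)
    (u : ℝ≥0 → NonlocalSPDE.Space d → Ω → ℝ) :
    NonlocalSPDE.IsWeakSolutionSPDE P 𝓕 B τ D f k γ δ η p q m n u ↔
      NonlocalSPDE.IsWeakSolutionRandomPDE P 𝓕 B τ D f k γ δ η p q m n
        (fun t x ω => Real.exp (-η * B t ω) * u t x ω) := by
  have hB0 := hB.ae_zero (by linarith)
  have hfield : NonlocalSPDE.IsSolutionField P 𝓕 τ D f q n u ↔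
      NonlocalSPDE.IsSolutionField P 𝓕 τ D f q n
        fun t x ω => Real.exp (-η * B t ω) * u t x ω := by
    refine ⟨fun h => h.exp_mul hD_open (by linarith) (by linarith) hB.continuous_paths hB0
      hB_adapted (-η), fun h => ?_⟩
    -- Multiplication by `exp (η B)` undoes the transformation, so the same lemma gives the
    -- converse.
    have h' := h.exp_mul hD_open (by linarith) (by linarith) hB.continuous_paths hB0 hB_adapted η
    have he : (fun t x ω => Real.exp (η * B t ω) * (Real.exp (-η * B t ω) * u t x ω)) = u := by
      ext t x ω
      rw [← mul_assoc, ← Real.exp_add]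
      simp
    rwa [he] at h'
  -- In both definitions the exceptional null set may depend on `φ`, so an equivalence for almost
  -- every path and one fixed `φ` suffices.
  have heq (hu : NonlocalSPDE.IsSolutionField P 𝓕 τ D f q n u) :
      ∀ φ, NonlocalSPDE.IsTestFunction D φ → ∀ᵐ ω ∂P, _ := fun φ hφ => by
    filter_upwards [hu.ae_isRegularPath, hB.continuous_paths,
      hB.ae_hasSmallSquaredIncrements hH] with ω hw hc hs
    exact NonlocalSPDE.tested_equation_iff (k := k) (γ := γ) (δ := δ) (η := η) hD_open hφ hw
      (zero_le_one.trans hp.le) hm (fun t ht => NonlocalSPDE.Icc_subset_of_lt ht) hc hs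
  constructor
  · intro h
    refine ⟨hfield.1 h.field, fun φ hφ => ?_⟩
    filter_upwards [heq h.field φ hφ, h.equation φ hφ] with ω h1 h2
    exact h1.1 h2
  · intro h
    have hu := hfield.2 h.field
    refine ⟨hu, fun φ hφ => ?_⟩
    filter_upwards [heq hu φ hφ, h.equation φ hφ] with ω h1 h2
    exact h1.2 h2
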